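/- **Setting.** Let $R$ be a commutative $\mathbb Q$-algebra (for example $\mathbb C$, or $\mathbb C[x_1^{\pm1},\dots,x_N^{\pm1}]$ with formal variables), let $l,N\ge 0$, and let $x_1,\dots,x_N\in R^\times$. Let $\mathcal M=R[a_{-1},a_{-2},\dots]$ be the Fock space of the Heisenberg algebra $[a_m,a_n]=m\delta_{m,-n}$: for $n\ge1$, $a_{-n}$ acts by multiplication and $a_n$ acts as $n\,\partial/\partial a_{-n}$. The vacuum is $|0\rangle=1$, and the dual vacuum $\langle 0|$ is the constant-term functional on $\mathcal M$. Define operators $Y_n,Y_n^*$ ($n\in\mathbb Z$) on $\mathcal M$ by $$Y(z)=\exp\Big(\sum_{n\ge1}\tfrac{a_{-n}}{n}z^n\Big)\exp\Big(-\sum_{n\ge1}\tfrac{a_n}{n}(z^{-n}+z^n)\Big)=\sum_{n\in\mathbb Z}Y_nz^{-n},$$ $$Y^*(z)=(1-z^2)\exp\Big(-\sum_{n\ge1}\tfrac{a_{-n}}{n}z^n\Big)\exp\Big(\sum_{n\ge1}\tfrac{a_n}{n}(z^{-n}+z^n)\Big)=\sum_{n\in\mathbb Z}Y^*_nz^{n},$$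 and put $$\Gamma_+(t)=\exp\Big(\sum_{n\ge1}\tfrac{a_n}{n}t^n\Big),\qquad \Gamma_+(\{x^\pm\})=\prod_{i=1}^N\Gamma_+(x_i)\Gamma_+(x_i^{-1}).$$ A generalized partition of length $k$ is a weakly decreasing sequence $\lambda=(\lambda_1,\dots,\lambda_k)$ of nonnegative integers (zero parts are allowed and counted in the length). For such $\lambda$ put $$|\lambda^{\rm sp}\rangle=Y_{-\lambda_1}Y_{-\lambda_2}\cdots Y_{-\lambda_k}|0\rangle,\qquad \langle\lambda^{\rm sp}|=\langle0|Y^*_{-\lambda_k}\cdots Y^*_{-\lambda_2}Y^*_{-\lambda_1}.$$ Define $h_n(x^\pm)$, $n\in\mathbb Z$, by $\prod_{i=1}^N\frac1{(1-x_iz)(1-x_i^{-1}z)}=\sum_{n\in\mathbb Z}h_n(x^\pm)z^n$ as a power series in $z$, so that $h_n(x^\pm)=0$ for $n<0$. **Proposition.** Let $\mu=(\mu_1,\dots,\mu_l)$ and $\lambda=(\lambda_1,\dots,\lambda_{l+N})$ be generalized partitions of lengths $l$ and $l+N$, and set $\mu_{l+1}=0$. Then the skew symplectic Schur function ${\rm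 sp}_{\lambda/\mu}(x^\pm)$, defined as the matrix element $\langle\mu^{\rm sp}|\Gamma_+(\{x^\pm\})|\lambda^{\rm sp}\rangle$, satisfies $${\rm sp}_{\lambda/\mu}(x^\pm)=\langle\mu^{\rm sp}|\Gamma_+(\{x^\pm\})|\lambda^{\rm sp}\rangle=\det(a_{ij})_{1\le i,j\le l+N},$$ where $$a_{ij}=\begin{cases}h_{\lambda_i-\mu_j-i+j}(x^\pm),&1\le j\le l+1,\\ h_{\lambda_i-i+j}(x^\pm)+h_{\lambda_i-i-j+2l+2}(x^\pm),&l+2\le j\le l+N.\end{cases}$$ -/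

import Mathlib

noncomputable section

namespace SympFock

open MvPolynomial

/-! ### The Fock space and the Heisenberg operators

Scalars are taken in an arbitrary commutative `ℚ`-algebra `S`, so that both complex values and
formal Laurent polynomials are allowed for the parameters of the vertex operators. -/

/-- The Fock space: the polynomial ring `S[a_{-1}, a_{-2}, …]`; the variable `X n` is `a_{-n}` and
the vacuum vector `|0⟩` is `1`. -/
abbrev Fock (S : Type*) [CommRing S] : Type _ := MvPolynomial ℕ+ S

section Heisenberg

variable {S : Type*} [CommRing S]

/-- The operator `a_{-n}` (`n ≥ 1`): multiplication by the variable `X n`. -/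
def create (n : ℕ+) : Module.End S (Fock S) := LinearMap.mulLeft S (X n)

/-- The operator `a_n` (`n ≥ 1`): `n · ∂/∂a_{-n}`. -/
def annihilate (n : ℕ+) : Module.End S (Fock S) := (n : ℕ) • (pderiv n).toLinearMap

/-- The dual vacuum `⟨0|`, as a linear form on the Fock space: the constant term. The completed
dual Fock space (the product of the duals of the finite-rank graded pieces) is the full dual
`Module.Dual S (Fock S)`; operators act on it from the right by composition. -/
def vacDual : Module.Dual S (Fock S) := lcoeff S 0

theorem vacDual_one : vacDual (1 : Fock S) = 1 := by
  simp [vacDual]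

theorem annihilate_one (n : ℕ+) : annihilate n (1 : Fock S) = 0 := by
  simp [annihilate]

theorem vacDual_comp_create (n : ℕ+) : (vacDual (S := S)) ∘ₗ create n = 0 := by
  ext1 m
  ext
  simp [vacDual, create, coeff_X_mul']

theorem annihilate_create (m n : ℕ+) :
    annihilate (S := S) m * create n - create n * annihilate m
      = if m = n then ((m : ℕ) : Module.End S (Fock S)) else 0 := by
  refine LinearMap.ext fun f => ?_
  by_cases h : m = n
  · subst h
    simp [annihilate, create, Derivation.leibniz]
    ring
  · simp [annihilate, create, Derivation.leibniz, h, pderiv_X_of_ne (Ne.symm h)]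
    ring

/-- The operator `∑_{n ≥ 1} (w_n / n) a_n` attached to a sequence `w` of scalars. As `a_n / n` is the
derivation `∂/∂a_{-n}`, this is the derivation with `X n ↦ w_n`; see `annihField_apply`. -/
def annihField (w : ℕ+ → S) : Module.End S (Fock S) :=
  (mkDerivation S fun n => (C (w n) : Fock S)).toLinearMap

theorem annihField_X_mul (w : ℕ+ → S) (n : ℕ+) (f : Fock S) :
    annihField w (X n * f) = X n * annihField w f + w n • f := by
  simp [annihField, Derivation.leibniz, mkDerivation_X, smul_eq_C_mul]
  ring

/-- The operator is locally nilpotent. -/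
theorem annihField_locNilp (w : ℕ+ → S) (f : Fock S) : ∃ k, (annihField w ^ k) f = 0 := by
  induction f using MvPolynomial.induction_on with
  | C a => exact ⟨1, by simp [annihField]⟩
  | add p q hp hq =>
    obtain ⟨i, hi⟩ := hp
    obtain ⟨j, hj⟩ := hq
    refine ⟨i + j, ?_⟩
    have h1 : (annihField w ^ (i + j)) p = 0 := by
      rw [add_comm, pow_add, Module.End.mul_apply, hi, map_zero]
    have h2 : (annihField w ^ (i + j)) q = 0 := by
      rw [pow_add, Module.End.mul_apply, hj, map_zero]
    rw [map_add, h1, h2, add_zero]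
  | mul_X p n hp =>
    obtain ⟨k, hk⟩ := hp
    refine ⟨k + 1, ?_⟩
    rw [mul_comm]
    induction k generalizing p with
    | zero =>
      have : p = 0 := by simpa using hk
      simp [this]
    | succ k ih =>
      rw [pow_succ, Module.End.mul_apply, annihField_X_mul, map_add, map_smul, hk, smul_zero,
        add_zero]
      exact ih (annihField w p) (by simpa [pow_succ] using hk)

theorem sum_derivation_apply (s : Finset ℕ+) (D : ℕ+ → Derivation S (Fock S) (Fock S))
    (f : Fock S) : (∑ n ∈ s, D n) f = ∑ n ∈ s, D n f := by
  classical
  induction s using Finset.induction_on with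
  | empty => simp
  | insert a s ha ih => rw [Finset.sum_insert ha, Finset.sum_insert ha, ← ih]; rfl

end Heisenberg

section Exponential

variable {S : Type*} [CommRing S] [Algebra ℚ S]

theorem annihField_apply (w : ℕ+ → S) (f : Fock S) :
    annihField w f = ∑ n ∈ f.vars, w n • ((n : ℕ) : ℚ)⁻¹ • annihilate n f := by
  have key : (mkDerivation S fun n => (C (w n) : Fock S)) f
      = (∑ n ∈ f.vars, w n • (pderiv n : Derivation S (Fock S) (Fock S))) f := by
    classical
    refine derivation_eq_of_forall_mem_vars fun i hi => ?_
    rw [mkDerivation_X, sum_derivation_apply, Finset.sum_eq_single i]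
    · simp [smul_eq_C_mul]
    · intro j _ hj
      simp [pderiv_X_of_ne hj.symm]
    · exact fun h => absurd hi h
  change (mkDerivation S fun n => (C (w n) : Fock S)) f = _
  rw [key, sum_derivation_apply]
  refine Finset.sum_congr rfl fun n _ => ?_
  have hn : ((n : ℕ) : ℚ) ≠ 0 := by exact_mod_cast n.ne_zero
  have h : ((n : ℕ) : ℚ)⁻¹ • annihilate n f = pderiv n f := by
    change ((n : ℕ) : ℚ)⁻¹ • ((n : ℕ) • pderiv n f) = pderiv n f
    rw [← Nat.cast_smul_eq_nsmul ℚ, smul_smul, inv_mul_cancel₀ hn, one_smul]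
  rw [h]
  rfl

/-- The exponential `exp T = ∑_k T^k / k!` of a locally nilpotent operator: on each vector the sum
is finite. -/
def locExp (T : Module.End S (Fock S)) (hT : ∀ f, ∃ k, (T ^ k) f = 0) :
    Module.End S (Fock S) where
  toFun f := ∑ᶠ k : ℕ, ((k.factorial : ℚ)⁻¹) • (T ^ k) f
  map_add' f g := by
    have fin : ∀ f, (Function.support fun k : ℕ => ((k.factorial : ℚ)⁻¹) • (T ^ k) f).Finite := by
      intro f
      obtain ⟨m, hm⟩ := hT f
      refine (Set.finite_lt_nat m).subset fun k hk => ?_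
      by_contra hlt
      obtain ⟨j, rfl⟩ := Nat.exists_eq_add_of_le (not_lt.mp hlt)
      exact hk (by simp [add_comm m j, pow_add, hm])
    simp only [map_add, smul_add]
    exact finsum_add_distrib (fin f) (fin g)
  map_smul' c f := by
    have fin : (Function.support fun k : ℕ => ((k.factorial : ℚ)⁻¹) • (T ^ k) f).Finite := by
      obtain ⟨m, hm⟩ := hT f
      refine (Set.finite_lt_nat m).subset fun k hk => ?_
      by_contra hlt
      obtain ⟨j, rfl⟩ := Nat.exists_eq_add_of_le (not_lt.mp hlt)
      exact hk (by simp [add_comm m j, pow_add, hm])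
    simp only [map_smul, RingHom.id_apply]
    rw [smul_finsum' c fin]
    exact finsum_congr fun k => smul_comm _ _ _

/-- `exp (∑_{n ≥ 1} (w_n / n) a_n)`. -/
def annihExp (w : ℕ+ → S) : Module.End S (Fock S) :=
  locExp (annihField w) (annihField_locNilp w)

end Exponential

section VertexOperators

theorem laurent_smul_eq {R : Type*} [CommRing R] (c : R) (F : LaurentSeries (Fock R)) :
    c • F = HahnSeries.C (C c : Fock R) * F := by
  refine HahnSeries.ext (funext fun k => ?_)
  rw [HahnSeries.C_mul_eq_smul]
  change c • F.coeff k = (C c : Fock R) • F.coeff k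
  rw [smul_eq_C_mul, smul_eq_mul]

variable {R : Type*} [CommRing R] [Algebra ℚ R]

/-- The series `∑_{n ≥ 1} (a_{-n} / n) z^n` with coefficients in the Fock space. -/
def creationSeries : PowerSeries (Fock R) :=
  PowerSeries.mk fun n =>
    if h : 0 < n then ((n : ℚ)⁻¹) • (X (⟨n, h⟩ : ℕ+) : Fock R) else 0

theorem hasSubst_creationSeries : PowerSeries.HasSubst (creationSeries (R := R)) :=
  PowerSeries.HasSubst.of_constantCoeff_zero' (by simp [creationSeries])

theorem hasSubst_neg_creationSeries : PowerSeries.HasSubst (-creationSeries (R := R)) :=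
  PowerSeries.HasSubst.of_constantCoeff_zero' (by simp [creationSeries])

/-- The variable `z`, as a unit of the ring of formal Laurent series over the Fock space. -/
def zUnit : (LaurentSeries (Fock R))ˣ where
  val := HahnSeries.single 1 1
  inv := HahnSeries.single (-1) 1
  val_inv := by simp
  inv_val := by simp

/-- Multiplication by a Laurent series. -/
def mulLaurent (E : LaurentSeries (Fock R)) :
    LaurentSeries (Fock R) →ₗ[R] LaurentSeries (Fock R) where
  toFun F := E * F
  map_add' F G := mul_add E F G
  map_smul' c F := by
    simp only [laurent_smul_eq, RingHom.id_apply]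
    exact mul_left_comm _ _ _

/-- The inclusion `R[z, z⁻¹][a_{-1}, a_{-2}, …] → R[a_{-1}, a_{-2}, …]((z))`. -/
def toLaurent : Fock (LaurentPolynomial R) →+* LaurentSeries (Fock R) :=
  eval₂Hom
    (LaurentPolynomial.eval₂ ((HahnSeries.C : Fock R →+* LaurentSeries (Fock R)).comp C) zUnit)
    fun n => HahnSeries.C (X n)

/-- `exp (∑_{n ≥ 1} (w_n / n) a_n)` with coefficients `w_n ∈ R[z, z⁻¹]`, as a map from the Fock
space to Laurent series in `z` over the Fock space. -/
def annihExpZ (w : ℕ+ → LaurentPolynomial R) : Fock R →ₗ[R] LaurentSeries (Fock R) where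
  toFun f := toLaurent (annihExp w (map LaurentPolynomial.C f))
  map_add' f g := by simp
  map_smul' c f := by
    simp only [smul_eq_C_mul, map_mul, map_C, RingHom.id_apply]
    rw [← smul_eq_C_mul, map_smul, smul_eq_C_mul, map_mul, laurent_smul_eq]
    congr 1
    simp [toLaurent]

/-- The vertex operator
`Y(z) = exp (∑ (a_{-n}/n) z^n) exp (- ∑ (a_n/n) (z^{-n} + z^n))`. -/
def vertexY : Fock R →ₗ[R] LaurentSeries (Fock R) :=
  mulLaurent
      (HahnSeries.ofPowerSeries ℤ (Fock R) ((PowerSeries.exp ℚ).subst (creationSeries (R := R))))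
    ∘ₗ annihExpZ fun n => -(LaurentPolynomial.T (-(n : ℤ)) + LaurentPolynomial.T (n : ℤ))

/-- The vertex operator
`Y*(z) = (1 - z²) exp (- ∑ (a_{-n}/n) z^n) exp (∑ (a_n/n) (z^{-n} + z^n))`. -/
def vertexYstar : Fock R →ₗ[R] LaurentSeries (Fock R) :=
  mulLaurent
      ((1 - HahnSeries.single 2 1) *
        HahnSeries.ofPowerSeries ℤ (Fock R)
          ((PowerSeries.exp ℚ).subst (-creationSeries (R := R))))
    ∘ₗ annihExpZ fun n => LaurentPolynomial.T (-(n : ℤ)) + LaurentPolynomial.T (n : ℤ)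

/-- Extraction of the coefficient of `z^k`. -/
def coeffZ (k : ℤ) : LaurentSeries (Fock R) →ₗ[R] Fock R where
  toFun F := F.coeff k
  map_add' _ _ := rfl
  map_smul' _ _ := rfl

/-- The mode `Y_n`, from `Y(z) = ∑_n Y_n z^{-n}`. -/
def modeY (n : ℤ) : Module.End R (Fock R) := coeffZ (-n) ∘ₗ vertexY

/-- The mode `Y*_n`, from `Y*(z) = ∑_n Y*_n z^n`. -/
def modeYstar (n : ℤ) : Module.End R (Fock R) := coeffZ n ∘ₗ vertexYstar

/-- `|λ^sp⟩ = Y_{-λ_1} Y_{-λ_2} ⋯ Y_{-λ_l} |0⟩`. -/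
def ketSp {l : ℕ} (lam : Fin l → ℕ) : Fock R :=
  (List.ofFn fun i => modeY (R := R) (-(lam i : ℤ))).prod 1

/-- `⟨λ^sp| = ⟨0| Y*_{-λ_l} ⋯ Y*_{-λ_2} Y*_{-λ_1}`. -/
def braSp {l : ℕ} (lam : Fin l → ℕ) : Module.Dual R (Fock R) :=
  vacDual ∘ₗ (List.ofFn fun i => modeYstar (R := R) (-(lam i : ℤ))).reverse.prod

/-- The half vertex operator `Γ₊(t) = exp (∑_{n ≥ 1} (a_n / n) t^n)`. -/
def gammaPlus (t : R) : Module.End R (Fock R) := annihExp fun n => t ^ (n : ℕ)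

/-- `Γ₊({x^±}) = ∏_{i=1}^N Γ₊(x_i) Γ₊(x_i⁻¹)`. -/
def gammaPlusPM {N : ℕ} (x : Fin N → Rˣ) : Module.End R (Fock R) :=
  (List.ofFn fun i => gammaPlus (x i : R) * gammaPlus ((x i)⁻¹ : Rˣ).val).prod

/-- The matrix element `⟨μ^sp| Γ₊({x^±}) |λ^sp⟩`, which is by definition the skew symplectic Schur
function `sp_{λ/μ}(x^±)`. -/
def skewSp {N l m : ℕ} (x : Fin N → Rˣ) (lam : Fin m → ℕ) (mu : Fin l → ℕ) : R :=
  braSp mu (gammaPlusPM x (ketSp lam))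

end VertexOperators

section CompleteHomogeneous

variable {R : Type*} [CommRing R]

/-- The polynomial `∏_{i=1}^N (1 - x_i z)(1 - x_i⁻¹ z)`, as a power series in `z`. -/
def hDenom {N : ℕ} (x : Fin N → Rˣ) : PowerSeries R :=
  ∏ i, ((1 - PowerSeries.C (x i : R) * PowerSeries.X) *
    (1 - PowerSeries.C ((x i)⁻¹ : Rˣ).val * PowerSeries.X))

/-- The complete homogeneous function `h_n(x^±)`, `n ∈ ℤ`: the coefficient of `z^n` in
`∏_{i=1}^N 1 / ((1 - x_i z)(1 - x_i⁻¹ z))`. -/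
def hPM {N : ℕ} (x : Fin N → Rˣ) (n : ℤ) : R :=
  if 0 ≤ n then PowerSeries.coeff n.toNat (PowerSeries.invOfUnit (hDenom x) 1) else 0

theorem hDenom_mul_mk_hPM {N : ℕ} (x : Fin N → Rˣ) :
    hDenom x * PowerSeries.mk (fun n : ℕ => hPM x n) = 1 := by
  have h : PowerSeries.mk (fun n : ℕ => hPM x n) = PowerSeries.invOfUnit (hDenom x) 1 := by
    ext n
    simp [hPM]
  rw [h]
  exact PowerSeries.mul_invOfUnit _ _ (by simp [hDenom, map_prod])

end CompleteHomogeneous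

end SympFock

end

noncomputable section

namespace SympFock

/-! ### Exponentials of annihilation operators are translations. -/

section AnnihExp

open MvPolynomial

variable {S : Type*} [CommRing S]

/-! Exponentials of annihilation operators translate the variables, so everything can be read off
generating series. Let h(t) = exp(∑ a_{-n} t^n / n), and let `shiftSum` act on coefficient sequences
as multiplication by t + t⁻¹. Indices below start at 0.

Ket. The translation in Y(z) turns h(t) into (1 - zt)(1 - z⁻¹t) h(t) = t (t + t⁻¹ - (z + z⁻¹)) h(t).
Bordering a determinant by a row of powers of z + z⁻¹ therefore gives, by induction, |λ⟩ =
det((`shiftSum`^j h)(λ_i - i)): this is `ketSp_eq_det`.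

Bra. Each Y*(w) adjoins letters w, w⁻¹ to the alphabet. Hence ⟨μ| specializes a_{-n} to ∑ (w_j^n +
w_j^{-n}), multiplies by a Weyl denominator, and takes the coefficient of ∏ w_j^{-μ_j} in iterated
Laurent series (`exists_braSp_eq`). The operator Γ₊ adds the letters x_i, x_i⁻¹, so h(t) becomes
h^x(t) / ∏ (1 - v_j t + t²), where h^x(t) = ∑ h_n(x^±) t^n and v_j = w_j + w_j⁻¹.

Separation of variables. The Weyl denominator contains the Vandermonde product of the v_j. That
product is the determinant of the passage from 1, X, X², … to the polynomials ∏_{m ≠ j} (X - v_m)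
for j < l, followed by P_p ∏_m (X - v_m) with P_p monic of degree p (`det_cauchySequence`). With X
acting as t + t⁻¹, column j < l keeps only the denominator 1 - v_j t + t², so it involves w_j alone;
the later columns keep none. The coefficient can then be extracted column by column
(`map_det_of_columns`). Expanding (1 - w²)/(1 - vt + t²) = ∑ (w^{-n} - w^{n+2}) t^n yields the
single entries, and taking P_p to express t^p + t^{-p} yields the two-term entries. -/

theorem annihField_pow_X_mul (w : ℕ+ → S) (n : ℕ+) (f : Fock S) (k : ℕ) :
    (annihField w ^ (k + 1)) (X n * f)
      = X n * (annihField w ^ (k + 1)) f + (k + 1) • w n • (annihField w ^ k) f := by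
  induction k with
  | zero => simp [annihField_X_mul]
  | succ k ih =>
    rw [pow_succ', Module.End.mul_apply, ih, map_add, annihField_X_mul, map_nsmul, map_smul,
      ← Module.End.mul_apply, ← pow_succ', ← Module.End.mul_apply, ← pow_succ', add_assoc,
      ← succ_nsmul']

variable [Algebra ℚ S]

theorem locExp_eq_sum_range (T : Module.End S (Fock S)) (hT : ∀ f, ∃ k, (T ^ k) f = 0)
    {f : Fock S} {m : ℕ} (hm : (T ^ m) f = 0) :
    locExp T hT f = ∑ k ∈ Finset.range m, ((k.factorial : ℚ)⁻¹) • (T ^ k) f := by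
  change ∑ᶠ k : ℕ, ((k.factorial : ℚ)⁻¹) • (T ^ k) f = _
  refine finsum_eq_sum_of_support_subset _ fun k hk => ?_
  simp only [Finset.coe_range, Set.mem_Iio]
  by_contra hlt
  obtain ⟨j, rfl⟩ := Nat.exists_eq_add_of_le (not_lt.mp hlt)
  exact hk (by simp [add_comm m j, pow_add, hm])

/-- The commutator of the field with `X n` is the scalar `w n`, so conjugation by the exponential
adds `w n` to `X n`. -/
theorem annihExp_X_mul (w : ℕ+ → S) (n : ℕ+) (f : Fock S) :
    annihExp w (X n * f) = (X n + C (w n)) * annihExp w f := by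
  obtain ⟨m, hm⟩ := annihField_locNilp w f
  have hm1 : (annihField w ^ (m + 1)) f = 0 := by
    rw [pow_succ', Module.End.mul_apply, hm, map_zero]
  have hm2 : (annihField w ^ (m + 1)) (X n * f) = 0 := by
    rw [annihField_pow_X_mul, hm1, hm]
    simp
  have key (k : ℕ) : (((k + 1).factorial : ℚ)⁻¹) • (annihField w ^ (k + 1)) (X n * f)
      = X n * ((((k + 1).factorial : ℚ)⁻¹) • (annihField w ^ (k + 1)) f)
        + C (w n) * ((k.factorial : ℚ)⁻¹) • (annihField w ^ k) f := by
    have hk : (((k + 1).factorial : ℚ)⁻¹) * ((k + 1 : ℕ) : ℚ) = (k.factorial : ℚ)⁻¹ := by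
      rw [Nat.factorial_succ]
      push_cast
      field_simp
    rw [annihField_pow_X_mul, smul_add, mul_smul_comm, ← hk, mul_smul, Nat.cast_smul_eq_nsmul,
      mul_smul_comm, mul_smul_comm, smul_eq_C_mul]
  rw [annihExp, locExp_eq_sum_range _ _ hm2, Finset.sum_range_succ', Finset.sum_congr rfl
    fun k _ => key k, Finset.sum_add_distrib, ← Finset.mul_sum, ← Finset.mul_sum,
    ← locExp_eq_sum_range _ (annihField_locNilp w) hm, add_mul]
  rw [locExp_eq_sum_range _ (annihField_locNilp w) hm1, Finset.sum_range_succ' _ m]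
  simp only [Nat.factorial_zero, Nat.cast_one, inv_one, pow_zero, one_smul, Module.End.one_apply]
  ring

/-- The exponential of a derivation of degree `-1` is the algebra map translating the variables. -/
theorem annihExp_apply (w : ℕ+ → S) (f : Fock S) :
    annihExp w f = aeval (fun n => X n + C (w n) : ℕ+ → Fock S) f := by
  induction f using MvPolynomial.induction_on with
  | C a =>
    have h : (annihField w ^ 1) (C a : Fock S) = 0 := by simp [annihField]
    rw [annihExp, locExp_eq_sum_range _ _ h]
    simp
  | add p q hp hq => rw [map_add, map_add, hp, hq]
  | mul_X p n hp => rw [mul_comm, annihExp_X_mul, hp, map_mul, aeval_X]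

end AnnihExp

/-! ### Power series characterized by their logarithmic derivatives. -/

section LogDeriv

open PowerSeries

variable {A B : Type*} [CommRing A] [CommRing B]

/-- The series `F` has constant coefficient `1` and logarithmic derivative `∑_{n ≥ 1} p_n z^{n-1}`;
that is, `F = exp (∑_{n ≥ 1} (p_n / n) z^n)`. -/
def HasPowerSums (p : ℕ+ → A) (F : PowerSeries A) : Prop :=
  constantCoeff F = 1 ∧ d⁄dX A F = PowerSeries.mk (fun n => p n.succPNat) * F

namespace HasPowerSums

theorem one : HasPowerSums (0 : ℕ+ → A) 1 := by
  refine ⟨by simp, ?_⟩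
  have : PowerSeries.mk (fun n : ℕ => (0 : ℕ+ → A) n.succPNat) = 0 := by ext; simp
  rw [this, derivative_one, zero_mul]

theorem mul {p q : ℕ+ → A} {F G : PowerSeries A} (hF : HasPowerSums p F) (hG : HasPowerSums q G) :
    HasPowerSums (p + q) (F * G) := by
  refine ⟨by simp [hF.1, hG.1], ?_⟩
  have : PowerSeries.mk (fun n : ℕ => (p + q) n.succPNat)
      = PowerSeries.mk (fun n : ℕ => p n.succPNat) + PowerSeries.mk (fun n => q n.succPNat) := by
    ext; simp
  rw [this, Derivation.leibniz, hF.2, hG.2]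
  simp only [smul_eq_mul]
  ring

theorem prod {ι : Type*} (s : Finset ι) {p : ι → ℕ+ → A} {F : ι → PowerSeries A}
    (h : ∀ i, HasPowerSums (p i) (F i)) : HasPowerSums (∑ i ∈ s, p i) (∏ i ∈ s, F i) := by
  classical
  induction s using Finset.induction_on with
  | empty => simpa using one
  | insert a s ha ih =>
    rw [Finset.sum_insert ha, Finset.prod_insert ha]
    exact (h a).mul ih

theorem map (g : A →+* B) {p : ℕ+ → A} {F : PowerSeries A} (hF : HasPowerSums p F) :
    HasPowerSums (fun n => g (p n)) (PowerSeries.map g F) := by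
  refine ⟨by rw [← coeff_zero_eq_constantCoeff_apply, coeff_map, coeff_zero_eq_constantCoeff_apply,
    hF.1, map_one], ?_⟩
  have h1 : d⁄dX B (PowerSeries.map g F) = PowerSeries.map g (d⁄dX A F) := by
    ext n
    simp [coeff_derivative]
  rw [h1, hF.2, map_mul]
  congr 1

theorem one_sub (y : A) : HasPowerSums (fun n => -y ^ (n : ℕ)) (1 - C y * X) := by
  refine ⟨by simp, ?_⟩
  ext n
  rw [mul_sub, mul_one, mul_left_comm, ← smul_eq_C_mul]
  rcases n with _ | n
  · simp
  · simp [coeff_succ_mul_X, coeff_one, pow_succ']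

/-- Over a `ℚ`-algebra a series is determined by its power sums. -/
theorem unique [Algebra ℚ A] {p : ℕ+ → A} {F G : PowerSeries A} (hF : HasPowerSums p F)
    (hG : HasPowerSums p G) : F = G := by
  have h (n : ℕ) : ∀ m ≤ n, coeff m F = coeff m G := by
    induction n with
    | zero =>
      intro m hm
      obtain rfl : m = 0 := by omega
      simp [hF.1, hG.1]
    | succ n ih =>
      intro m hm
      rcases Nat.lt_or_eq_of_le hm with hlt | rfl
      · exact ih m (by omega)
      have e : coeff n (d⁄dX A F) = coeff n (d⁄dX A G) := by
        rw [hF.2, hG.2, coeff_mul, coeff_mul]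
        refine Finset.sum_congr rfl fun x hx => ?_
        rw [ih _ (by have := Finset.HasAntidiagonal.mem_antidiagonal.mp hx; omega)]
      rw [coeff_derivative, coeff_derivative] at e
      -- The differential equation gives the coefficient of degree n + 1 only up to the factor n +
      -- 1; this is where rational scalars are needed.
      have hu : IsUnit ((n : A) + 1) := by
        have : IsUnit (algebraMap ℚ A ((n : ℚ) + 1)) :=
          (IsUnit.mk0 _ (by positivity)).map _
        simpa using this
      exact hu.mul_right_cancel e
  ext n
  exact h n n le_rfl

end HasPowerSums

end LogDeriv

/-! ### The complete and elementary generating series of the Fock space. -/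

section Exponentials

open PowerSeries

/-- Moves the exponential to coefficients in `A`, where the chain rule for the derivative is
applied. -/
theorem exp_subst_eq {A : Type*} [CommRing A] [Algebra ℚ A] {g : PowerSeries A}
    (hg : PowerSeries.HasSubst g) :
    (PowerSeries.exp ℚ).subst g = (PowerSeries.exp A).subst g := by
  ext n
  rw [coeff_subst' hg, coeff_subst' hg]
  refine finsum_congr fun d => ?_
  simp [coeff_exp, Algebra.smul_def]

theorem hasPowerSums_exp_subst {A : Type*} [CommRing A] [Algebra ℚ A] {g : PowerSeries A}
    (hg : constantCoeff g = 0) :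
    HasPowerSums (fun n => (n : A) * coeff (n : ℕ) g) ((PowerSeries.exp ℚ).subst g) := by
  have hs : PowerSeries.HasSubst g := PowerSeries.HasSubst.of_constantCoeff_zero' hg
  refine ⟨?_, ?_⟩
  · rw [← coeff_zero_eq_constantCoeff_apply, coeff_subst' hs, finsum_eq_single _ 0]
    · simp
    · intro d hd
      simp [hg, hd]
  · rw [exp_subst_eq hs, derivative_subst hs, derivative_exp, mul_comm]
    congr 1
    ext n
    simp [coeff_derivative, mul_comm]

variable {R : Type*} [CommRing R] [Algebra ℚ R]

/-- The generating series `∑_n h_n z^n = exp (∑ (a_{-n}/n) z^n)` of the complete homogeneous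
elements of the Fock space. -/
def completeSeries : PowerSeries (Fock R) := (PowerSeries.exp ℚ).subst (creationSeries (R := R))

/-- The series `exp (-∑ (a_{-n}/n) z^n)`. -/
def elementarySeries : PowerSeries (Fock R) :=
  (PowerSeries.exp ℚ).subst (-creationSeries (R := R))

theorem mul_coeff_creationSeries (n : ℕ+) :
    (n : Fock R) * coeff (n : ℕ) (creationSeries (R := R)) = MvPolynomial.X n := by
  have hn : ((n : ℕ) : ℚ) ≠ 0 := by exact_mod_cast n.ne_zero
  rw [creationSeries, coeff_mk, dif_pos n.pos, ← nsmul_eq_mul, ← Nat.cast_smul_eq_nsmul ℚ,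
    smul_smul, mul_inv_cancel₀ hn, one_smul]
  rfl

theorem hasPowerSums_completeSeries :
    HasPowerSums MvPolynomial.X (completeSeries (R := R)) := by
  have h := hasPowerSums_exp_subst (g := creationSeries (R := R)) (by simp [creationSeries])
  simp only [mul_coeff_creationSeries] at h
  exact h

theorem hasPowerSums_elementarySeries :
    HasPowerSums (fun n => -MvPolynomial.X n) (elementarySeries (R := R)) := by
  have h := hasPowerSums_exp_subst (g := -creationSeries (R := R)) (by simp [creationSeries])
  simp only [map_neg, mul_neg, mul_coeff_creationSeries] at h
  exact h

end Exponentials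

/-! ### Coefficient sequences and multiplication by t + t⁻¹. -/

section LaurentTools

variable {A B : Type*} [CommRing A] [CommRing B]

/-- The coefficientwise map of Laurent series along a ring homomorphism. -/
def mapLaurent (g : A →+* B) : LaurentSeries A →+* LaurentSeries B where
  toFun F := HahnSeries.map F g
  map_zero' := HahnSeries.ext (funext fun _ => map_zero g)
  map_one' := HahnSeries.map_one g.toMonoidWithZeroHom
  map_add' _ _ := HahnSeries.map_add (g : A →+ B)
  map_mul' _ _ := HahnSeries.map_mul (g : A →ₙ+* B)

@[simp]
theorem coeff_mapLaurent (g : A →+* B) (F : LaurentSeries A) (n : ℤ) :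
    (mapLaurent g F).coeff n = g (F.coeff n) := rfl

@[simp]
theorem mapLaurent_single (g : A →+* B) (n : ℤ) (a : A) :
    mapLaurent g (HahnSeries.single n a) = HahnSeries.single n (g a) := by
  ext m
  by_cases h : m = n <;> simp [h]

@[simp]
theorem mapLaurent_C (g : A →+* B) (a : A) :
    mapLaurent g (HahnSeries.C a) = HahnSeries.C (g a) :=
  mapLaurent_single g 0 a

theorem mapLaurent_ofPowerSeries (g : A →+* B) (F : PowerSeries A) :
    mapLaurent g (HahnSeries.ofPowerSeries ℤ A F)
      = HahnSeries.ofPowerSeries ℤ B (PowerSeries.map g F) := by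
  ext n
  rw [coeff_mapLaurent, PowerSeries.coeff_coe, PowerSeries.coeff_coe]
  split_ifs <;> simp

theorem coeff_C_mul (a : A) (F : LaurentSeries A) (n : ℤ) :
    (HahnSeries.C a * F).coeff n = a * F.coeff n := by
  rw [HahnSeries.C_mul_eq_smul, HahnSeries.coeff_smul, smul_eq_mul]

/-- The coefficients of a power series, as a sequence on `ℤ`. -/
def toSeq (F : PowerSeries A) (n : ℤ) : A := (HahnSeries.ofPowerSeries ℤ A F).coeff n

theorem toSeq_map (g : A →+* B) (F : PowerSeries A) (n : ℤ) :
    toSeq (PowerSeries.map g F) n = g (toSeq F n) := by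
  rw [toSeq, ← mapLaurent_ofPowerSeries, coeff_mapLaurent, toSeq]

theorem toSeq_natCast (F : PowerSeries A) (n : ℕ) : toSeq F n = PowerSeries.coeff n F :=
  HahnSeries.ofPowerSeries_apply_coeff F n

theorem toSeq_of_neg (F : PowerSeries A) {n : ℤ} (hn : n < 0) : toSeq F n = 0 := by
  rw [toSeq, PowerSeries.coeff_coe, if_pos hn]

/-- The operator `h_n ↦ h_{n-1} + h_{n+1}` on sequences: multiplication of the generating series by
`t + t⁻¹`. -/
def shiftSum (A : Type*) [CommRing A] : Module.End A (ℤ → A) where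
  toFun h n := h (n - 1) + h (n + 1)
  map_add' h h' := by ext n; simp only [Pi.add_apply]; ring
  map_smul' c h := by ext n; simp only [Pi.smul_apply, smul_eq_mul, RingHom.id_apply]; ring

theorem shiftSum_apply (h : ℤ → A) (n : ℤ) : shiftSum A h n = h (n - 1) + h (n + 1) := rfl

theorem shiftSum_pow_succ_apply (h : ℤ → A) (j : ℕ) (n : ℤ) :
    (shiftSum A ^ (j + 1)) h n
      = (shiftSum A ^ j) h (n - 1) + (shiftSum A ^ j) h (n + 1) := by
  rw [pow_succ', Module.End.mul_apply, shiftSum_apply]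

theorem map_shiftSum_pow (g : A →+* B) (h : ℤ → A) (j : ℕ) (n : ℤ) :
    g ((shiftSum A ^ j) h n) = (shiftSum B ^ j) (fun m => g (h m)) n := by
  induction j generalizing n with
  | zero => simp
  | succ j ih => rw [shiftSum_pow_succ_apply, shiftSum_pow_succ_apply, map_add, ih, ih]

theorem shiftSum_pow_translate (h : ℤ → A) (c : ℤ) (j : ℕ) (n : ℤ) :
    (shiftSum A ^ j) (fun m => h (m + c)) n = (shiftSum A ^ j) h (n + c) := by
  induction j generalizing n with
  | zero => simp
  | succ j ih =>
    rw [shiftSum_pow_succ_apply, shiftSum_pow_succ_apply, ih, ih, sub_add_eq_add_sub,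
      add_right_comm]

/-- Multiplication of a series by `1 - v t + t² = t (t + t⁻¹ - v)`. -/
theorem toSeq_quadratic_mul (v : A) (F : PowerSeries A) (n : ℤ) :
    toSeq ((1 - PowerSeries.C v * PowerSeries.X + PowerSeries.X ^ 2) * F) n
      = shiftSum A (toSeq F) (n - 1) - v * toSeq F (n - 1) := by
  have h : HahnSeries.ofPowerSeries ℤ A
      ((1 - PowerSeries.C v * PowerSeries.X + PowerSeries.X ^ 2) * F)
      = HahnSeries.ofPowerSeries ℤ A F
        - HahnSeries.C v * (HahnSeries.single 1 1 * HahnSeries.ofPowerSeries ℤ A F)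
        + HahnSeries.single 2 1 * HahnSeries.ofPowerSeries ℤ A F := by
    simp only [map_mul, map_add, map_sub, map_one, HahnSeries.ofPowerSeries_C,
      HahnSeries.ofPowerSeries_X_pow, HahnSeries.ofPowerSeries_X]
    push_cast
    ring
  rw [toSeq, h, HahnSeries.coeff_add, HahnSeries.coeff_sub, coeff_C_mul,
    HahnSeries.coeff_single_mul, HahnSeries.coeff_single_mul, one_mul, one_mul, shiftSum_apply]
  simp only [toSeq]
  rw [show n - 1 - 1 = n - 2 by ring, show n - 1 + 1 = n by ring]
  ring

theorem coeff_mul_pow_eq_shiftSum (F : LaurentSeries A) (j : ℕ) (n : ℤ) :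
    (F * (HahnSeries.single 1 1 + HahnSeries.single (-1) 1) ^ j).coeff n
      = (shiftSum A ^ j) F.coeff n := by
  induction j generalizing n with
  | zero => simp
  | succ j ih =>
    rw [pow_succ, ← mul_assoc, mul_add, HahnSeries.coeff_add, HahnSeries.coeff_mul_single,
      HahnSeries.coeff_mul_single, ih, ih, shiftSum_pow_succ_apply]
    simp

end LaurentTools

/-! ### Vertex operators as a series times a ring homomorphism. -/

section VertexOperatorFormulas

open MvPolynomial

variable {R : Type*} [CommRing R]

theorem val_zUnit_zpow (n : ℤ) :
    ((zUnit ^ n : (LaurentSeries (Fock R))ˣ) : LaurentSeries (Fock R)) = HahnSeries.single n 1 := by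
  have h (m : ℕ) : ((zUnit ^ m : (LaurentSeries (Fock R))ˣ) : LaurentSeries (Fock R))
      = HahnSeries.single (m : ℤ) 1 := by
    rw [Units.val_pow_eq_pow_val]
    simp [zUnit, HahnSeries.single_pow]
  obtain ⟨m, rfl | rfl⟩ := n.eq_nat_or_neg
  · rw [zpow_natCast, h]
  · rw [zpow_neg, zpow_natCast, ← inv_pow, Units.val_pow_eq_pow_val]
    simp [zUnit, HahnSeries.single_pow]

/-- The ring homomorphism `a_{-n} ↦ a_{-n} + w_n` from the Fock space to Laurent series. -/
def translateZ (w : ℕ+ → LaurentPolynomial R) : Fock R →+* LaurentSeries (Fock R) :=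
  toLaurent.comp ((aeval (fun n => X n + C (w n) : ℕ+ → Fock (LaurentPolynomial R))).toRingHom.comp
    (map LaurentPolynomial.C))

theorem translateZ_X (w : ℕ+ → LaurentPolynomial R) (n : ℕ+) :
    translateZ w (X n) = HahnSeries.C (X n) + LaurentPolynomial.eval₂
      ((HahnSeries.C : Fock R →+* LaurentSeries (Fock R)).comp C) zUnit (w n) := by
  simp [translateZ, toLaurent]

theorem translateZ_C (w : ℕ+ → LaurentPolynomial R) (r : R) :
    translateZ w (C r) = HahnSeries.C (C r) := by
  simp [translateZ, toLaurent]

/-- The ring homomorphism part of `Y*(z)`. -/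
def raiseZ : Fock R →+* LaurentSeries (Fock R) :=
  translateZ fun n => LaurentPolynomial.T (-(n : ℤ)) + LaurentPolynomial.T (n : ℤ)

/-- The ring homomorphism part of `Y(z)`. -/
def lowerZ : Fock R →+* LaurentSeries (Fock R) :=
  translateZ fun n => -(LaurentPolynomial.T (-(n : ℤ)) + LaurentPolynomial.T (n : ℤ))

theorem raiseZ_X (n : ℕ+) : raiseZ (X n : Fock R)
    = HahnSeries.C (X n) + (HahnSeries.single (-(n : ℤ)) 1 + HahnSeries.single (n : ℤ) 1) := by
  rw [raiseZ, translateZ_X, map_add, LaurentPolynomial.eval₂_T, LaurentPolynomial.eval₂_T,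
    val_zUnit_zpow, val_zUnit_zpow]

theorem lowerZ_X (n : ℕ+) : lowerZ (X n : Fock R)
    = HahnSeries.C (X n) - (HahnSeries.single (-(n : ℤ)) 1 + HahnSeries.single (n : ℤ) 1) := by
  rw [lowerZ, translateZ_X, map_neg, map_add, LaurentPolynomial.eval₂_T, LaurentPolynomial.eval₂_T,
    val_zUnit_zpow, val_zUnit_zpow, sub_eq_add_neg]

variable [Algebra ℚ R]

theorem annihExpZ_apply (w : ℕ+ → LaurentPolynomial R) (f : Fock R) :
    annihExpZ w f = translateZ w f := by
  change toLaurent (annihExp w (map LaurentPolynomial.C f)) = _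
  rw [annihExp_apply]
  rfl

theorem vertexY_apply (f : Fock R) :
    vertexY f = HahnSeries.ofPowerSeries ℤ (Fock R) completeSeries * lowerZ f := by
  change _ * annihExpZ _ f = _
  rw [annihExpZ_apply]
  rfl

theorem vertexYstar_apply (f : Fock R) :
    vertexYstar f = (1 - HahnSeries.single 2 1) *
      HahnSeries.ofPowerSeries ℤ (Fock R) elementarySeries * raiseZ f := by
  change _ * annihExpZ _ f = _
  rw [annihExpZ_apply]
  rfl

theorem modeY_apply (m : ℤ) (f : Fock R) : modeY (-m) f
    = (HahnSeries.ofPowerSeries ℤ (Fock R) completeSeries * lowerZ f).coeff m := by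
  rw [← vertexY_apply]
  change (vertexY f).coeff (- -m) = _
  rw [neg_neg]

theorem modeYstar_apply (m : ℤ) (f : Fock R) : modeYstar m f
    = ((1 - HahnSeries.single 2 1) *
      HahnSeries.ofPowerSeries ℤ (Fock R) elementarySeries * raiseZ f).coeff m := by
  rw [← vertexYstar_apply]
  rfl

end VertexOperatorFormulas

/-! ### The ket as a determinant. -/

section Ket

variable {R : Type*} [CommRing R] [Algebra ℚ R]

/-- The variable sum `z + z⁻¹`. -/
def zSum (A : Type*) [CommRing A] : LaurentSeries A :=
  HahnSeries.single 1 1 + HahnSeries.single (-1) 1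

/-- Subtracting z^n + z^{-n} from the n-th power sum multiplies the generating series by (1 - zt)(1
- z⁻¹t). -/
theorem map_lowerZ_completeSeries :
    PowerSeries.map lowerZ (completeSeries (R := R))
      = (1 - PowerSeries.C (zSum (Fock R)) * PowerSeries.X + PowerSeries.X ^ 2) *
        PowerSeries.map HahnSeries.C completeSeries := by
  have h := ((HasPowerSums.one_sub (HahnSeries.single 1 1 : LaurentSeries (Fock R))).mul
    (HasPowerSums.one_sub (HahnSeries.single (-1) 1 : LaurentSeries (Fock R)))).mul
      (hasPowerSums_completeSeries.map HahnSeries.C)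
  have e : (1 - PowerSeries.C (HahnSeries.single 1 1 : LaurentSeries (Fock R)) * PowerSeries.X) *
      (1 - PowerSeries.C (HahnSeries.single (-1) 1 : LaurentSeries (Fock R)) * PowerSeries.X)
      = 1 - PowerSeries.C (zSum (Fock R)) * PowerSeries.X + PowerSeries.X ^ 2 := by
    have h1 : PowerSeries.C (HahnSeries.single 1 1 : LaurentSeries (Fock R))
        * PowerSeries.C (HahnSeries.single (-1) 1 : LaurentSeries (Fock R)) = 1 := by
      rw [← map_mul]
      simp
    rw [zSum, map_add]
    linear_combination PowerSeries.X ^ 2 * h1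
  rw [e] at h
  refine HasPowerSums.unique (hasPowerSums_completeSeries.map lowerZ) ?_
  convert h using 1
  funext n
  rw [lowerZ_X]
  simp [HahnSeries.single_pow]
  ring

/-- Since 1 - ut + t² = t (t + t⁻¹ - u) for u = z + z⁻¹, the effect is a translation of the index
and one more factor `shiftSum` - u; `shiftSum` commutes with both translations and scalars. -/
theorem lowerZ_shiftSum_pow (j : ℕ) (n : ℤ) :
    lowerZ ((shiftSum (Fock R) ^ j) (toSeq completeSeries) n)
      = HahnSeries.C ((shiftSum (Fock R) ^ (j + 1)) (toSeq completeSeries) (n - 1))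
        - zSum (Fock R) * HahnSeries.C ((shiftSum (Fock R) ^ j) (toSeq completeSeries) (n - 1)) := by
  set h : ℤ → LaurentSeries (Fock R) := toSeq (PowerSeries.map HahnSeries.C completeSeries)
    with hh
  have e1 : (fun m => lowerZ (toSeq (completeSeries (R := R)) m))
      = fun m => (shiftSum _ h - zSum (Fock R) • h) (m + -1) := by
    funext m
    rw [← toSeq_map, map_lowerZ_completeSeries, toSeq_quadratic_mul]
    rfl
  have e2 : (fun m => HahnSeries.C (toSeq (completeSeries (R := R)) m)) = h := by
    funext m
    rw [hh, toSeq_map]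
  rw [map_shiftSum_pow, map_shiftSum_pow, map_shiftSum_pow, e1, e2, shiftSum_pow_translate,
    map_sub, map_smul, ← Module.End.mul_apply, ← pow_succ]
  rfl

theorem ketSp_succ {k : ℕ} (lam : Fin (k + 1) → ℕ) :
    ketSp (R := R) lam = modeY (-(lam 0 : ℤ)) (ketSp fun i => lam i.succ) := by
  simp [ketSp, List.ofFn_succ]

/-- Determinant formula for `|λ^sp⟩`. -/
theorem ketSp_eq_det {k : ℕ} (lam : Fin k → ℕ) :
    ketSp (R := R) lam = Matrix.det (Matrix.of fun i j : Fin k =>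
      (shiftSum (Fock R) ^ (j : ℕ)) (toSeq completeSeries) ((lam i : ℤ) - (i : ℕ))) := by
  induction k with
  | zero => simp [ketSp]
  | succ k ih =>
    rw [ketSp_succ, modeY_apply, ih, RingHom.map_det]
    set u := zSum (Fock R) with hu
    set H : ℕ → Fin k → Fock R := fun j i =>
      (shiftSum (Fock R) ^ j) (toSeq completeSeries) ((lam i.succ : ℤ) - (i.succ : ℕ)) with hH
    -- The rows for λ_1, …, λ_k are bordered above by (1, u, u², …). Subtracting u times the
    -- preceding column turns this row into (1, 0, …, 0), and the remaining minor is the image under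
    -- `lowerZ` of the smaller determinant.
    let M : Matrix (Fin (k + 1)) (Fin (k + 1)) (LaurentSeries (Fock R)) :=
      Matrix.of fun i j => Fin.cases (u ^ (j : ℕ)) (fun i => HahnSeries.C (H j i)) i
    let M' : Matrix (Fin (k + 1)) (Fin (k + 1)) (LaurentSeries (Fock R)) :=
      Matrix.of fun i j => Fin.cases (M i 0) (fun j => M i j.succ - u * M i j.castSucc) j
    have h1 : M.det = M'.det := by
      refine Matrix.det_eq_of_forall_col_eq_smul_add_pred (fun _ => u) (fun i => ?_)
        fun i j => ?_
      · simp [M']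
      · simp [M']
    have h2 : M'.det = ((lowerZ (R := R)).mapMatrix (Matrix.of fun i j : Fin k =>
        (shiftSum (Fock R) ^ (j : ℕ)) (toSeq completeSeries)
          ((lam i.succ : ℤ) - (i : ℕ)))).det := by
      rw [Matrix.det_succ_row_zero, Fin.sum_univ_succ, Finset.sum_eq_zero]
      · have : M'.submatrix Fin.succ (Fin.succAbove 0) = (lowerZ (R := R)).mapMatrix
            (Matrix.of fun i j : Fin k => (shiftSum (Fock R) ^ (j : ℕ)) (toSeq completeSeries)
              ((lam i.succ : ℤ) - (i : ℕ))) := by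
          ext1 i j
          simp only [Matrix.submatrix_apply, RingHom.mapMatrix_apply, Matrix.map_apply,
            Matrix.of_apply, lowerZ_shiftSum_pow, M', M, H, Fin.succAbove_zero, Fin.cases_succ,
            Fin.val_succ, Fin.val_castSucc]
          push_cast
          rw [sub_sub]
        rw [this]
        simp [M', M]
      · intro j _
        simp [M', M, pow_succ']
    -- Only the top row of `M` depends on z. Taking the coefficient of z^{λ_0} in h(z) u^j replaces
    -- its entry u^j by that of the wanted matrix.
    rw [← h2, ← h1, Matrix.det_succ_row_zero, Matrix.det_succ_row_zero, Finset.mul_sum,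
      HahnSeries.coeff_sum]
    refine Finset.sum_congr rfl fun j _ => ?_
    have h3 : (M.submatrix Fin.succ j.succAbove).det = HahnSeries.C
        ((Matrix.of fun i j : Fin (k + 1) => (shiftSum (Fock R) ^ (j : ℕ)) (toSeq completeSeries)
          ((lam i : ℤ) - (i : ℕ))).submatrix Fin.succ j.succAbove).det := by
      rw [RingHom.map_det]
      congr 1
    have h4 : ((-1) ^ (j : ℕ) : LaurentSeries (Fock R)) = HahnSeries.C ((-1) ^ (j : ℕ)) := by
      rw [map_pow, map_neg, map_one]
    have h5 : M 0 j = u ^ (j : ℕ) := rfl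
    have h6 : HahnSeries.ofPowerSeries ℤ (Fock R) completeSeries
        * ((-1) ^ (j : ℕ) * M 0 j * (M.submatrix Fin.succ j.succAbove).det)
        = HahnSeries.C ((-1) ^ (j : ℕ)) * (HahnSeries.C
          ((Matrix.of fun i j : Fin (k + 1) => (shiftSum (Fock R) ^ (j : ℕ)) (toSeq completeSeries)
            ((lam i : ℤ) - (i : ℕ))).submatrix Fin.succ j.succAbove).det
          * (HahnSeries.ofPowerSeries ℤ (Fock R) completeSeries * u ^ (j : ℕ))) := by
      rw [h3, h4, h5]
      ring
    rw [h6, coeff_C_mul, coeff_C_mul, hu, zSum, coeff_mul_pow_eq_shiftSum]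
    simp only [Matrix.of_apply, Fin.val_zero, Nat.cast_zero, sub_zero]
    change _ * (_ * (shiftSum (Fock R) ^ (j : ℕ)) (toSeq completeSeries) _) = _
    ring

end Ket

/-! ### Specialization at an alphabet closed under inversion. -/

section PowerSumSpecialization

open MvPolynomial

variable {A : Type*} [CommRing A]

/-- The power sum `∑_j (w_j^n + w_j^{-n})`. -/
def powerSumPM {l : ℕ} (w : Fin l → Aˣ) (n : ℕ+) : A :=
  ∑ j, ((w j : A) ^ (n : ℕ) + (((w j)⁻¹ : Aˣ) : A) ^ (n : ℕ))

theorem map_powerSumPM {B : Type*} [CommRing B] (g : A →+* B) {l : ℕ} (w : Fin l → Aˣ) (n : ℕ+) :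
    g (powerSumPM w n) = powerSumPM (fun j => Units.map (g : A →* B) (w j)) n := by
  simp only [powerSumPM, map_sum, map_add, map_pow, ← map_inv, Units.coe_map]
  rfl

theorem map_hDenom {B : Type*} [CommRing B] (g : A →+* B) {l : ℕ} (w : Fin l → Aˣ) :
    PowerSeries.map g (hDenom w) = hDenom fun j => Units.map (g : A →* B) (w j) := by
  simp only [hDenom, map_prod, map_mul, map_sub, map_one, PowerSeries.map_C, PowerSeries.map_X,
    ← map_inv, Units.coe_map]
  rfl

theorem hasPowerSums_hDenom {l : ℕ} (w : Fin l → Aˣ) :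
    HasPowerSums (fun n => -powerSumPM w n) (hDenom w) := by
  have h := HasPowerSums.prod Finset.univ fun j =>
    (HasPowerSums.one_sub (w j : A)).mul (HasPowerSums.one_sub (((w j)⁻¹ : Aˣ) : A))
  refine (congrArg (HasPowerSums · (hDenom w)) ?_).mp h
  funext n
  simp only [powerSumPM, Finset.sum_apply, Pi.add_apply, ← Finset.sum_neg_distrib]
  exact Finset.sum_congr rfl fun j _ => (neg_add _ _).symm

variable {R : Type*} [CommRing R] [Algebra ℚ R]

theorem map_elementarySeries [Algebra ℚ A] {l : ℕ} {w : Fin l → Aˣ} {g : Fock R →+* A}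
    (hg : ∀ n, g (X n) = powerSumPM w n) : PowerSeries.map g elementarySeries = hDenom w := by
  refine (hasPowerSums_elementarySeries.map g).unique ?_
  convert hasPowerSums_hDenom w using 1
  funext n
  rw [map_neg, hg]

theorem map_completeSeries_mul [Algebra ℚ A] {l N : ℕ} {w : Fin l → Aˣ} {x : Fin N → Aˣ}
    {g : Fock R →+* A} (hg : ∀ n, g (X n) = powerSumPM w n + powerSumPM x n) :
    PowerSeries.map g completeSeries * (hDenom w * hDenom x) = 1 := by
  refine HasPowerSums.unique ((hasPowerSums_completeSeries.map g).mul
    ((hasPowerSums_hDenom w).mul (hasPowerSums_hDenom x))) ?_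
  convert HasPowerSums.one using 1
  funext n
  simp only [Pi.add_apply, Pi.zero_apply, hg]
  ring

end PowerSumSpecialization

/-! ### The bra as coefficient extraction in iterated Laurent series. -/

section Bra

open MvPolynomial

/-- The product `∏_j (1 - w_j²) ∏_{i<j} (1 - w_i w_j) (1 - w_i w_j⁻¹)`. -/
def weylFactor {A : Type*} [CommRing A] {l : ℕ} (w : Fin l → Aˣ) : A :=
  ∏ j, ((1 - (w j : A) ^ 2) * ∏ i ∈ Finset.Ioi j,
    ((1 - (w j : A) * w i) * (1 - (w j : A) * ((w i)⁻¹ : Aˣ))))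

/-- The variable of the ring of Laurent series, as a unit. -/
def laurentVar (A : Type*) [CommRing A] : (LaurentSeries A)ˣ where
  val := HahnSeries.single 1 1
  inv := HahnSeries.single (-1) 1
  val_inv := by simp
  inv_val := by simp

theorem laurentVar_zpow (A : Type*) [CommRing A] (n : ℤ) :
    ((laurentVar A ^ n : (LaurentSeries A)ˣ) : LaurentSeries A) = HahnSeries.single n 1 := by
  have h (m : ℕ) : ((laurentVar A ^ m : (LaurentSeries A)ˣ) : LaurentSeries A)
      = HahnSeries.single (m : ℤ) 1 := by
    rw [Units.val_pow_eq_pow_val]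
    simp [laurentVar, HahnSeries.single_pow]
  obtain ⟨m, rfl | rfl⟩ := n.eq_nat_or_neg
  · rw [zpow_natCast, h]
  · rw [zpow_neg, zpow_natCast, ← inv_pow, Units.val_pow_eq_pow_val]
    simp [laurentVar, HahnSeries.single_pow]

variable {R : Type*} [CommRing R]

theorem coeff_eval₂_laurentVar {A : Type*} [CommRing A] (ι : R →+* A) (F : LaurentPolynomial R)
    (m : ℤ) : (LaurentPolynomial.eval₂ ((HahnSeries.C : A →+* LaurentSeries A).comp ι)
      (laurentVar A) F).coeff m = ι (F.coeff m) := by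
  induction F using LaurentPolynomial.induction_on' with
  | add p q hp hq => simp [hp, hq]
  | C_mul_T n a =>
    rw [LaurentPolynomial.eval₂_C_mul_T, laurentVar_zpow, RingHom.comp_apply, coeff_C_mul,
      ← LaurentPolynomial.single_eq_C_mul_T]
    by_cases h : m = n
    · subst h; simp [-LaurentPolynomial.single_eq_C_mul_T]
    · simp [h, -LaurentPolynomial.single_eq_C_mul_T]

theorem eval₂_map_unit {A B : Type*} [CommRing A] [CommRing B] (f : R →+* A) (g : A →+* B)
    (u : Aˣ) (F : LaurentPolynomial R) :
    LaurentPolynomial.eval₂ (g.comp f) (Units.map (g : A →* B) u) F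
      = g (LaurentPolynomial.eval₂ f u F) := by
  induction F using LaurentPolynomial.induction_on' with
  | add p q hp hq => simp [hp, hq]
  | C_mul_T n a =>
    rw [LaurentPolynomial.eval₂_C_mul_T, LaurentPolynomial.eval₂_C_mul_T, ← map_zpow, map_mul]
    rfl

theorem weylFactor_succ {A : Type*} [CommRing A] {l : ℕ} (w : Fin (l + 1) → Aˣ) :
    weylFactor w = (1 - (w 0 : A) ^ 2) * (∏ i : Fin l,
      ((1 - (w 0 : A) * w i.succ) * (1 - (w 0 : A) * ((w i.succ)⁻¹ : Aˣ)))) *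
        weylFactor fun j => w j.succ := by
  simp only [weylFactor, Fin.prod_univ_succ, Fin.prod_Ioi_zero, Fin.prod_Ioi_succ]

theorem map_weylFactor {A B : Type*} [CommRing A] [CommRing B] (g : A →+* B) {l : ℕ}
    (w : Fin l → Aˣ) : g (weylFactor w) = weylFactor fun j => Units.map (g : A →* B) (w j) := by
  simp only [weylFactor, map_prod, map_mul, map_sub, map_one, map_pow, ← map_inv, Units.coe_map]
  rfl

variable [Algebra ℚ R]

theorem braSp_succ {l : ℕ} (mu : Fin (l + 1) → ℕ) (f : Fock R) :
    braSp mu f = braSp (fun j => mu j.succ) (modeYstar (-(mu 0 : ℤ)) f) := by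
  simp [braSp, List.ofFn_succ]

end Bra

universe u

open MvPolynomial in
/-- The form `⟨μ^sp|` is extraction of the coefficient of `∏_j w_j^{-μ_j}`, applied to the Weyl
factor times the specialization of the Fock space at the alphabet `w_j, w_j⁻¹`. -/
theorem exists_braSp_eq {R : Type u} [CommRing R] [Algebra ℚ R] {l : ℕ} (mu : Fin l → ℕ) :
    ∃ (A : Type u) (_ : CommRing A) (ι : R →+* A) (w : Fin l → Aˣ) (κ : A →+ R),
      (∀ r a, κ (ι r * a) = r * κ a) ∧
      (∀ f : Fock R, braSp mu f = κ (weylFactor w * eval₂Hom ι (powerSumPM w) f)) ∧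
      ∀ F : Fin l → LaurentPolynomial R,
        κ (∏ j, LaurentPolynomial.eval₂ ι (w j) (F j)) = ∏ j, (F j).coeff (-(mu j : ℤ)) := by
  induction l with
  | zero =>
    refine ⟨R, inferInstance, RingHom.id R, fun j => j.elim0, AddMonoidHom.id R, fun _ _ => rfl,
      fun f => ?_, fun F => by simp⟩
    have h : (powerSumPM (fun j : Fin 0 => (j.elim0 : Rˣ))) = fun _ => 0 := by
      funext n
      simp [powerSumPM]
    rw [h]
    simp [braSp, weylFactor, vacDual, MvPolynomial.constantCoeff_eq]
  | succ l ih =>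
    obtain ⟨A, _, ι, w, κ, h0, h1, h2⟩ := ih fun j => mu j.succ
    let c : LaurentSeries A →+ A :=
      { toFun F := F.coeff (-(mu 0 : ℤ))
        map_zero' := rfl
        map_add' _ _ := rfl }
    -- The operator with index μ_0 acts first on the vector, so its variable is the outermost one
    -- and its coefficient is taken first.
    let W : Fin (l + 1) → (LaurentSeries A)ˣ := Fin.cons (laurentVar A)
      fun j => Units.map (HahnSeries.C : A →+* LaurentSeries A) (w j)
    have hc (F : LaurentSeries A) : κ.comp c F = κ (F.coeff (-(mu 0 : ℤ))) := rfl
    refine ⟨LaurentSeries A, inferInstance, HahnSeries.C.comp ι, W, κ.comp c, fun r a => ?_,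
      fun f => ?_, fun F => ?_⟩
    · rw [hc, hc, RingHom.comp_apply, coeff_C_mul, h0]
    · let _ : Algebra ℚ A := (ι.comp (algebraMap ℚ R)).toAlgebra
      set g : Fock R →+* A := eval₂Hom ι (powerSumPM w) with hg
      have e1 : PowerSeries.map g elementarySeries = hDenom w :=
        map_elementarySeries fun n => by simp [hg]
      have e2 : mapLaurent g (raiseZ f) = eval₂Hom
          ((HahnSeries.C : A →+* LaurentSeries A).comp ι) (powerSumPM W) f := by
        have : (mapLaurent g).comp raiseZ = eval₂Hom
            ((HahnSeries.C : A →+* LaurentSeries A).comp ι) (powerSumPM W) := by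
          refine MvPolynomial.ringHom_ext (fun r => ?_) fun n => ?_
          · rw [RingHom.comp_apply, raiseZ, translateZ_C, mapLaurent_C, hg, eval₂Hom_C,
              eval₂Hom_C, RingHom.comp_apply]
          · rw [RingHom.comp_apply, raiseZ_X, map_add, map_add, mapLaurent_C, mapLaurent_single,
              mapLaurent_single, hg, eval₂Hom_X', eval₂Hom_X', map_one, map_powerSumPM]
            rw [powerSumPM, powerSumPM, Fin.sum_univ_succ, add_comm]
            congr 1
            simp [W, laurentVar, HahnSeries.single_pow, add_comm]
        exact congrArg (fun φ => φ f) this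
      -- The factors of the Weyl denominator that involve the new variable z are exactly the scalar
      -- part of Y*(z): 1 - z² times the specialized elementary series.
      have e3 : weylFactor W = HahnSeries.C (weylFactor w) * ((1 - HahnSeries.single 2 1) *
          HahnSeries.ofPowerSeries ℤ A (hDenom w)) := by
        rw [weylFactor_succ, map_weylFactor, mul_comm]
        congr 2
        · simp [W, laurentVar, HahnSeries.single_pow]
        · rw [hDenom, map_prod]
          refine Finset.prod_congr rfl fun i _ => ?_
          simp only [map_mul, map_sub, map_one, HahnSeries.ofPowerSeries_C,
            HahnSeries.ofPowerSeries_X]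
          rw [mul_comm (HahnSeries.C _), mul_comm (HahnSeries.C _)]
          rfl
      rw [braSp_succ, h1, modeYstar_apply, hc, ← coeff_mapLaurent, ← coeff_C_mul, map_mul,
        map_mul, mapLaurent_ofPowerSeries, e1, e2, e3, map_sub, map_one, mapLaurent_single, map_one,
        mul_assoc (HahnSeries.C (weylFactor w))]
    · rw [Fin.prod_univ_succ, Fin.prod_univ_succ, ← h2]
      have e1 : ∏ j : Fin l, LaurentPolynomial.eval₂
          ((HahnSeries.C : A →+* LaurentSeries A).comp ι) (W j.succ) (F j.succ)
          = HahnSeries.C (∏ j : Fin l, LaurentPolynomial.eval₂ ι (w j) (F j.succ)) := by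
        rw [map_prod]
        exact Finset.prod_congr rfl fun j _ => eval₂_map_unit _ _ _ _
      have e2 : W 0 = laurentVar A := rfl
      rw [e1, e2, mul_comm, hc, coeff_C_mul, coeff_eval₂_laurentVar, mul_comm, h0]

/-! ### Determinants of linear functionals on polynomials. -/

section PolynomialDeterminants

open Polynomial

variable {A : Type*} [CommRing A]

/-- `P_j` is of degree at most `j`, with coefficient `1` in degree `j`, for all `j`. -/
def IsMonicSequence (P : ℕ → A[X]) : Prop :=
  ∀ j, (P j).natDegree ≤ j ∧ (P j).coeff j = 1

theorem det_monicSequence {k : ℕ} (T : Fin k → A[X] →ₗ[A] A) {P : ℕ → A[X]}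
    (hP : IsMonicSequence P) :
    (Matrix.of fun i j : Fin k => T i (P j)).det
      = (Matrix.of fun i j : Fin k => T i (X ^ (j : ℕ))).det := by
  have h : (Matrix.of fun i j : Fin k => T i (P j))
      = (Matrix.of fun i j : Fin k => T i (X ^ (j : ℕ))) *
        Matrix.of fun i j : Fin k => (P j).coeff i := by
    ext i j
    rw [Matrix.mul_apply, Matrix.of_apply, Polynomial.as_sum_range_C_mul_X_pow' (P j)
      (Nat.lt_of_le_of_lt (hP j).1 j.2), map_sum, Finset.sum_range]
    refine Finset.sum_congr rfl fun m _ => ?_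
    rw [← smul_eq_C_mul, map_smul, smul_eq_mul, mul_comm]
    rfl
  rw [h, Matrix.det_mul, Matrix.det_of_isUpperTriangular
    (Matrix.matrixOfPolynomials_blockTriangular (fun j : Fin k => P j) fun j => (hP j).1)]
  simp [(hP _).2]

/-- The sequence of polynomials `∏_{m < l, m ≠ j} (X - v_m)` for `j < l`, followed by the
`P_{j-l} ∏_{m < l} (X - v_m)` for `j ≥ l`. -/
def cauchySequence (v : ℕ → A) (P : ℕ → A[X]) (l j : ℕ) : A[X] :=
  if j < l then ∏ m ∈ (Finset.range l).erase j, (X - C (v m))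
  else (∏ m ∈ Finset.range l, (X - C (v m))) * P (j - l)

theorem IsMonicSequence.cons_mul {P : ℕ → A[X]} (hP : IsMonicSequence P) (a : A) :
    IsMonicSequence fun j => if j = 0 then 1 else (X - C a) * P (j - 1) := by
  intro j
  rcases j with _ | j
  · simp
  · have h := hP j
    have h1 : (P j).coeff (j + 1) = 0 := coeff_eq_zero_of_natDegree_lt (by omega)
    refine ⟨?_, ?_⟩
    · simp only [Nat.add_eq_zero_iff, one_ne_zero, and_false, if_false, Nat.add_sub_cancel]
      refine natDegree_mul_le.trans ?_
      have := natDegree_X_sub_C_le a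
      omega
    · simp [sub_mul, coeff_X_mul, h.2, h1]

/-- Confluent Cauchy–Vandermonde evaluation, in terms of linear functionals on polynomials. -/
theorem det_cauchySequence {k : ℕ} (T : Fin k → A[X] →ₗ[A] A) (v : ℕ → A) {l : ℕ} (hl : l ≤ k)
    {P : ℕ → A[X]} (hP : IsMonicSequence P) :
    (Matrix.of fun i j : Fin k => T i (cauchySequence v P l j)).det
      = (∏ j ∈ Finset.range l, ∏ i ∈ Finset.range j, (v i - v j)) *
        (Matrix.of fun i j : Fin k => T i (X ^ (j : ℕ))).det := by
  induction l generalizing P with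
  | zero => simpa [cauchySequence] using det_monicSequence T hP
  | succ l ih =>
    -- The factor X - v_l is absorbed into the monic tail. For j < l, writing X - v_l = (X - v_j) +
    -- (v_j - v_l) shows that the new column is v_j - v_l times the old one plus column l; the other
    -- columns are unchanged.
    set P' : ℕ → A[X] := fun j => if j = 0 then 1 else (X - C (v l)) * P (j - 1) with hP'
    let col : Fin k := ⟨l, hl⟩
    let d : Fin k → A := fun j => if (j : ℕ) < l then v j - v l else 1
    have hP0 : P 0 = 1 := by
      rw [eq_C_of_natDegree_le_zero (hP 0).1, (hP 0).2, C_1]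
    have key (j : ℕ) : cauchySequence v P (l + 1) j
        = (if j < l then v j - v l else 1) • cauchySequence v P' l j
          + (if j < l then (1 : A) else 0) • cauchySequence v P (l + 1) l := by
      have hcol : cauchySequence v P (l + 1) l = ∏ m ∈ Finset.range l, (X - C (v m)) := by
        rw [cauchySequence, if_pos (Nat.lt_succ_self l), Finset.range_add_one,
          Finset.erase_insert (by simp)]
      rcases lt_trichotomy j l with h | h | h
      · rw [hcol, cauchySequence, if_pos (by omega), cauchySequence, if_pos h, if_pos h, if_pos h,
          Finset.range_add_one, Finset.erase_insert_of_ne h.ne', Finset.prod_insert (by simp),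
          ← Finset.mul_prod_erase _ _ (Finset.mem_range.mpr h), one_smul, smul_eq_C_mul, C_sub]
        ring
      · subst h
        rw [hcol, cauchySequence]
        simp [hP']
      · obtain ⟨p, rfl⟩ := Nat.exists_eq_add_of_lt h
        rw [cauchySequence, if_neg (by omega), cauchySequence, if_neg (by omega),
          if_neg (by omega), if_neg (by omega), one_smul, zero_smul, add_zero,
          Finset.prod_range_succ, hP']
        simp only [show l + p + 1 - l = p + 1 by omega, show l + p + 1 - (l + 1) = p by omega]
        simp [mul_assoc]
    have h1 : (Matrix.of fun i j : Fin k => T i (cauchySequence v P (l + 1) j)).det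
        = (Matrix.of fun i j : Fin k => d j * T i (cauchySequence v P' l j)).det := by
      rw [← Matrix.det_transpose, ← Matrix.det_transpose (Matrix.of fun i j : Fin k => d j * _)]
      refine Matrix.det_eq_of_forall_row_eq_smul_add_const
        (fun j : Fin k => if (j : ℕ) < l then (1 : A) else 0) col (by simp [col]) fun j i => ?_
      have hc := key l
      simp only [lt_irrefl, if_false, one_smul, zero_smul, add_zero] at hc
      have hj := congrArg (T i) (key j)
      rw [map_add, map_smul, map_smul, smul_eq_mul, smul_eq_mul, hc] at hj
      simp only [Matrix.transpose_apply, Matrix.of_apply, hj, d, col, lt_irrefl, if_false, one_mul]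
    have h2 : ∏ j : Fin k, d j = ∏ i ∈ Finset.range l, (v i - v l) := by
      rw [← Finset.prod_range fun j => if j < l then v j - v l else 1, ← Finset.prod_filter]
      refine Finset.prod_congr ?_ fun _ _ => rfl
      ext m
      simp only [Finset.mem_filter, Finset.mem_range]
      omega
    have h3 := Matrix.det_mul_row d (Matrix.of fun i j : Fin k => T i (cauchySequence v P' l j))
    simp only [Matrix.of_apply] at h3
    rw [h1, h3, h2, ih (by omega) (hP.cons_mul (v l)), Finset.prod_range_succ]
    ring

/-- The polynomials `1, X, X² - 2, …` expressing `1` and the `t^p + t^{-p}` in `t + t⁻¹`. -/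
def dicksonSequence (A : Type*) [CommRing A] (p : ℕ) : A[X] :=
  if p = 0 then 1 else Chebyshev.C A p

theorem isMonicSequence_dicksonSequence : IsMonicSequence (dicksonSequence A) := by
  have h (p : ℕ) : ((Chebyshev.C A (p + 1 : ℕ)).natDegree ≤ p + 1 ∧
      (Chebyshev.C A (p + 1 : ℕ)).coeff (p + 1) = 1) := by
    induction p using Nat.twoStepInduction with
    | zero => simp [natDegree_X_le]
    | one =>
      have : Chebyshev.C A ((1 + 1 : ℕ) : ℤ) = X ^ 2 - C 2 := by
        push_cast
        exact Chebyshev.C_two A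
      rw [this]
      refine ⟨by compute_degree, by simp [coeff_X_pow]⟩
    | more p h0 h1 =>
      have : Chebyshev.C A ((p + 2 + 1 : ℕ) : ℤ)
          = X * Chebyshev.C A ((p + 1 + 1 : ℕ) : ℤ) - Chebyshev.C A ((p + 1 : ℕ) : ℤ) := by
        have := Chebyshev.C_add_two A ((p + 1 : ℕ) : ℤ)
        push_cast at this ⊢
        convert this using 2
        ring_nf
      have hc : (Chebyshev.C A ((p + 1 : ℕ) : ℤ)).coeff (p + 2 + 1) = 0 :=
        coeff_eq_zero_of_natDegree_lt (by omega)
      rw [this]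
      refine ⟨(natDegree_sub_le _ _).trans (max_le (natDegree_mul_le.trans ?_) (by omega)), ?_⟩
      · have := natDegree_X_le (R := A)
        omega
      · rw [coeff_sub, coeff_X_mul, h1.2, hc, sub_zero]
  intro j
  rcases j with _ | j
  · simp [dicksonSequence]
  · simpa [dicksonSequence] using h j

/-- The operator form of C_p(t + t⁻¹) = t^p + t^{-p}. At p = 0 it gives 2, which is why
`dicksonSequence` starts with 1 instead. -/
theorem aeval_shiftSum_chebyshev (h : ℤ → A) (p : ℕ) (n : ℤ) :
    aeval (shiftSum A) (Chebyshev.C A p) h n = h (n - p) + h (n + p) := by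
  induction p using Nat.twoStepInduction generalizing n with
  | zero =>
    rw [Nat.cast_zero, Chebyshev.C_zero, map_ofNat]
    simp [← two_mul]
  | one => simp [shiftSum_apply]
  | more p h0 h1 =>
    have : Chebyshev.C A ((p + 2 : ℕ) : ℤ)
        = X * Chebyshev.C A ((p + 1 : ℕ) : ℤ) - Chebyshev.C A (p : ℤ) := by
      push_cast
      exact Chebyshev.C_add_two A p
    rw [this, map_sub, map_mul, aeval_X, LinearMap.sub_apply, Module.End.mul_apply, Pi.sub_apply,
      shiftSum_apply, h0, h1, h1]
    push_cast
    rw [show n - 1 - ((p : ℤ) + 1) = n - (p + 2) by ring,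
      show n - 1 + ((p : ℤ) + 1) = n + p by ring, show n + 1 - ((p : ℤ) + 1) = n - p by ring,
      show n + 1 + ((p : ℤ) + 1) = n + (p + 2) by ring]
    ring

/-- The power series `1 - v t + t²`. -/
def quadratic (v : A) : PowerSeries A :=
  1 - PowerSeries.C v * PowerSeries.X + PowerSeries.X ^ 2

/-- Each factor t + t⁻¹ - v equals t⁻¹ (1 - vt + t²), and the t⁻¹ shifts the index by one. -/
theorem aeval_shiftSum_prod (v : ℕ → A) (s : Finset ℕ) (F : PowerSeries A) (n : ℤ) :
    aeval (shiftSum A) (∏ m ∈ s, (X - C (v m))) (toSeq F) n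
      = toSeq ((∏ m ∈ s, quadratic (v m)) * F) (n + s.card) := by
  induction s using Finset.induction_on generalizing n with
  | empty => simp
  | insert a s ha ih =>
    rw [Finset.prod_insert ha, Finset.prod_insert ha, Finset.card_insert_of_notMem ha, mul_assoc,
      quadratic, toSeq_quadratic_mul, map_mul, map_sub, aeval_X, aeval_C, Module.End.mul_apply,
      LinearMap.sub_apply, Pi.sub_apply, shiftSum_apply, shiftSum_apply, Module.algebraMap_end_apply,
      Pi.smul_apply, smul_eq_mul, ih, ih, ih]
    push_cast
    rw [show n - 1 + (s.card : ℤ) = n + (s.card + 1) - 1 - 1 by ring,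
      show n + 1 + (s.card : ℤ) = n + (s.card + 1) - 1 + 1 by ring,
      show n + (s.card : ℤ) = n + (s.card + 1) - 1 by ring]

end PolynomialDeterminants

/-! ### The operator Γ₊ as a single translation. -/

section GammaPlus

open MvPolynomial

variable {R : Type*} [CommRing R] [Algebra ℚ R]

theorem annihExp_zero : annihExp (0 : ℕ+ → R) = 1 := by
  refine LinearMap.ext fun f => ?_
  rw [annihExp_apply]
  simp

theorem annihExp_add (v w : ℕ+ → R) : annihExp (v + w) = annihExp v * annihExp w := by
  refine LinearMap.ext fun f => ?_
  rw [Module.End.mul_apply, annihExp_apply, annihExp_apply, annihExp_apply]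
  have h : (aeval (fun n => X n + C (v n) : ℕ+ → Fock R)).comp
      (aeval (fun n => X n + C (w n) : ℕ+ → Fock R))
      = aeval (fun n => X n + C ((v + w) n) : ℕ+ → Fock R) := by
    refine MvPolynomial.algHom_ext fun n => ?_
    simp [algebraMap_eq, add_assoc]
  rw [← h]
  rfl

theorem gammaPlusPM_eq {N : ℕ} (x : Fin N → Rˣ) : gammaPlusPM x = annihExp (powerSumPM x) := by
  induction N with
  | zero =>
    have h : powerSumPM x = 0 := by
      funext n
      simp [powerSumPM]
    rw [h, annihExp_zero]
    simp [gammaPlusPM]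
  | succ N ih =>
    have h : powerSumPM x = ((fun n : ℕ+ => (x 0 : R) ^ (n : ℕ)) +
        fun n : ℕ+ => (((x 0)⁻¹ : Rˣ) : R) ^ (n : ℕ)) + powerSumPM fun i => x i.succ := by
      funext n
      simp [powerSumPM, Fin.sum_univ_succ]
    have h2 : gammaPlusPM x = gammaPlus (x 0 : R) * gammaPlus (((x 0)⁻¹ : Rˣ) : R) *
        gammaPlusPM fun i => x i.succ := by
      simp [gammaPlusPM, List.ofFn_succ]
    rw [h2, ih, h, annihExp_add, annihExp_add]
    rfl

end GammaPlus

/-! ### Factorization of the Weyl denominator. -/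

section WeylDenominator

variable {A : Type*} [CommRing A]

/-- The sums `w_m + w_m⁻¹`, extended by zero. -/
def unitSum {l : ℕ} (w : Fin l → Aˣ) (m : ℕ) : A :=
  if h : m < l then (w ⟨m, h⟩ : A) + ((w ⟨m, h⟩)⁻¹ : Aˣ) else 0

theorem unitSum_val {l : ℕ} (w : Fin l → Aˣ) (j : Fin l) :
    unitSum w j = (w j : A) + ((w j)⁻¹ : Aˣ) := by
  simp [unitSum]

theorem hDenom_eq_prod_quadratic {l : ℕ} (w : Fin l → Aˣ) :
    hDenom w = ∏ m ∈ Finset.range l, quadratic (unitSum w m) := by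
  rw [Finset.prod_range, hDenom]
  refine Finset.prod_congr rfl fun j _ => ?_
  have h : PowerSeries.C (w j : A) * PowerSeries.C (((w j)⁻¹ : Aˣ) : A) = 1 := by
    rw [← map_mul, Units.mul_inv, map_one]
  rw [unitSum_val, quadratic, map_add]
  linear_combination PowerSeries.X ^ 2 * h

/-- Each pair of factors is (1 - w_j w_i)(1 - w_j w_i⁻¹) = w_j (v_j - v_i), and index j has l - 1 -
j larger partners. The Vandermonde part will be absorbed by `det_cauchySequence`, the rest by
scaling single columns. -/
theorem weylFactor_eq {l : ℕ} (w : Fin l → Aˣ) :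
    weylFactor w = (∏ j : Fin l, ((w j : A) ^ (l - 1 - (j : ℕ)) * (1 - (w j : A) ^ 2))) *
      ∏ j ∈ Finset.range l, ∏ i ∈ Finset.range j, (unitSum w i - unitSum w j) := by
  have h1 (j : Fin l) : ∏ i ∈ Finset.Ioi j,
      ((1 - (w j : A) * w i) * (1 - (w j : A) * ((w i)⁻¹ : Aˣ)))
      = (w j : A) ^ (l - 1 - (j : ℕ)) * ∏ i ∈ Finset.Ioi j, (unitSum w j - unitSum w i) := by
    rw [← Fin.card_Ioi, ← Finset.prod_const, ← Finset.prod_mul_distrib]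
    refine Finset.prod_congr rfl fun i _ => ?_
    rw [unitSum_val, unitSum_val]
    have e1 := Units.mul_inv (w i)
    have e2 := Units.mul_inv (w j)
    linear_combination (w j : A) ^ 2 * e1 - e2
  have h2 : ∏ j : Fin l, ∏ i ∈ Finset.Ioi j, (unitSum w j - unitSum w i)
      = ∏ j ∈ Finset.range l, ∏ i ∈ Finset.range j, (unitSum w i - unitSum w j) := by
    rw [Finset.prod_range]
    have e1 (j : Fin l) : ∏ i ∈ Finset.range j, (unitSum w i - unitSum w j)
        = ∏ i : Fin l, if i < j then unitSum w i - unitSum w j else 1 := by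
      rw [Finset.prod_ite, Finset.prod_const_one, mul_one]
      symm
      refine Finset.prod_bij (fun i _ => (i : ℕ)) ?_ ?_ ?_ ?_
      · intro i hi
        exact Finset.mem_range.mpr (Fin.lt_def.mp (Finset.mem_filter.mp hi).2)
      · intro i _ i' _ h
        exact Fin.ext h
      · intro m hm
        have hm' := Finset.mem_range.mp hm
        exact ⟨⟨m, hm'.trans j.2⟩, Finset.mem_filter.mpr ⟨Finset.mem_univ _, Fin.lt_def.mpr hm'⟩,
          rfl⟩
      · intro i _
        rfl
    rw [Finset.prod_congr rfl fun j _ => e1 j, Finset.prod_comm]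
    refine Finset.prod_congr rfl fun j _ => ?_
    rw [← Finset.prod_filter]
    refine Finset.prod_congr ?_ fun _ _ => rfl
    ext i
    simp
  rw [weylFactor, ← h2, ← Finset.prod_mul_distrib]
  refine Finset.prod_congr rfl fun j _ => ?_
  rw [h1]
  ring

/-- The series `∑_n (w^{-n} - w^{n+2}) t^n`. -/
def antisymSeries (w : Aˣ) : PowerSeries A :=
  PowerSeries.mk fun n => (((w⁻¹ : Aˣ) : A) ^ n - (w : A) ^ (n + 2))

theorem quadratic_mul_antisymSeries (w : Aˣ) :
    quadratic ((w : A) + ((w⁻¹ : Aˣ) : A)) * antisymSeries w = PowerSeries.C (1 - (w : A) ^ 2) := by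
  have e := Units.mul_inv w
  ext n
  rw [quadratic, add_mul, sub_mul, one_mul, mul_assoc, map_add, map_sub, PowerSeries.coeff_C_mul,
    PowerSeries.coeff_C]
  rcases n with _ | _ | n
  · simp [antisymSeries, PowerSeries.coeff_X_pow_mul']
  · simp [antisymSeries, PowerSeries.coeff_X_pow_mul', PowerSeries.coeff_succ_X_mul]
    linear_combination (w : A) * e
  · simp [antisymSeries, PowerSeries.coeff_X_pow_mul', PowerSeries.coeff_succ_X_mul]
    linear_combination ((w : A) ^ (n + 2) - ((w⁻¹ : Aˣ) : A) ^ n) * e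

end WeylDenominator

/-! ### Coefficient extraction, column by column. -/

section ColumnExtraction

variable {R : Type*} [CommRing R]

/-- The Laurent polynomial `∑_n h_{m-n} (T^{s-n} - T^{s+n+2})`. -/
def antisymPoly (h : ℤ → R) (s : ℕ) (m : ℤ) : LaurentPolynomial R :=
  ∑ n ∈ Finset.range (m.toNat + 1), LaurentPolynomial.C (h (m - n)) *
    (LaurentPolynomial.T ((s : ℤ) - n) - LaurentPolynomial.T ((s : ℤ) + n + 2))

/-- The exponents s + n + 2 are positive and never equal -p ≤ 0, so only n = p + s contributes. If
that n lies beyond the truncation, the index m - n is negative and h vanishes there. -/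
theorem coeff_antisymPoly {h : ℤ → R} (hneg : ∀ n < 0, h n = 0) (s p : ℕ) (m : ℤ) :
    (antisymPoly h s m).coeff (-(p : ℤ)) = h (m - (p + s)) := by
  have e (n : ℕ) : (LaurentPolynomial.C (h (m - n)) *
      (LaurentPolynomial.T ((s : ℤ) - n) - LaurentPolynomial.T ((s : ℤ) + n + 2))).coeff (-(p : ℤ))
      = if n = p + s then h (m - n) else 0 := by
    rw [mul_sub, ← LaurentPolynomial.single_eq_C_mul_T, ← LaurentPolynomial.single_eq_C_mul_T]
    have h1 : (s : ℤ) + n + 2 ≠ -(p : ℤ) := by omega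
    have h2 : (s : ℤ) - n = -(p : ℤ) ↔ n = p + s := by omega
    simp [-LaurentPolynomial.single_eq_C_mul_T, Finsupp.single_apply, h1, h2]
  have e' : (antisymPoly h s m).coeff (-(p : ℤ))
      = ∑ n ∈ Finset.range (m.toNat + 1), if n = p + s then h (m - n) else 0 := by
    rw [← Finset.sum_congr rfl fun n _ => e n]
    simp [antisymPoly]
  rw [e', Finset.sum_ite_eq' _ _ fun n : ℕ => h (m - n)]
  split_ifs with hc
  · push_cast
    rfl
  · rw [hneg]
    simp only [Finset.mem_range] at hc
    omega

variable {A : Type*} [CommRing A]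

theorem eval₂_antisymPoly (ι : R →+* A) (w : Aˣ) (F : PowerSeries R) (s : ℕ) (m : ℤ) :
    LaurentPolynomial.eval₂ ι w (antisymPoly (toSeq F) s m)
      = (w : A) ^ s * toSeq (PowerSeries.map ι F * antisymSeries w) m := by
  have e (n : ℕ) : LaurentPolynomial.eval₂ ι w (LaurentPolynomial.C (toSeq F (m - n)) *
      (LaurentPolynomial.T ((s : ℤ) - n) - LaurentPolynomial.T ((s : ℤ) + n + 2)))
      = (w : A) ^ s * (ι (toSeq F (m - n)) * (((w⁻¹ : Aˣ) : A) ^ n - (w : A) ^ (n + 2))) := by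
    have h1 : ((w ^ ((s : ℤ) - n) : Aˣ) : A) = (w : A) ^ s * ((w⁻¹ : Aˣ) : A) ^ n := by
      rw [sub_eq_add_neg, zpow_add, zpow_neg, zpow_natCast, zpow_natCast, ← inv_pow]
      simp
    have h2 : ((w ^ ((s : ℤ) + n + 2) : Aˣ) : A) = (w : A) ^ s * (w : A) ^ (n + 2) := by
      rw [add_assoc, zpow_add, zpow_natCast, show (n : ℤ) + 2 = ((n + 2 : ℕ) : ℤ) by simp,
        zpow_natCast]
      simp
    rw [map_mul, map_sub, LaurentPolynomial.eval₂_C, LaurentPolynomial.eval₂_T,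
      LaurentPolynomial.eval₂_T, h1, h2]
    ring
  rw [antisymPoly, map_sum, Finset.sum_congr rfl fun n _ => e n, ← Finset.mul_sum]
  congr 1
  rcases lt_or_ge m 0 with hm | hm
  · rw [toSeq_of_neg _ hm, Finset.sum_eq_zero]
    intro n _
    rw [toSeq_of_neg _ (by omega), map_zero, zero_mul]
  · obtain ⟨k, rfl⟩ := Int.eq_ofNat_of_zero_le hm
    rw [toSeq_natCast, mul_comm, PowerSeries.coeff_mul, Finset.Nat.sum_antidiagonal_eq_sum_range_succ_mk,
      Int.toNat_natCast]
    refine Finset.sum_congr rfl fun n hn => ?_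
    have hn' : n ≤ k := by
      have := Finset.mem_range.mp hn
      omega
    rw [← Nat.cast_sub hn', toSeq_natCast, PowerSeries.coeff_map, antisymSeries,
      PowerSeries.coeff_mk, mul_comm]

/-- A determinant whose first columns depend on one variable each, the others on none, may be
computed by applying a product of functionals column by column. -/
theorem map_det_of_columns {l N : ℕ} (ι : R →+* A) (w : Fin l → Aˣ) (κ : A →+ R)
    (c : Fin l → ℤ) (hι : ∀ r a, κ (ι r * a) = r * κ a)
    (hκ : ∀ F : Fin l → LaurentPolynomial R,
      κ (∏ j, LaurentPolynomial.eval₂ ι (w j) (F j)) = ∏ j, (F j).coeff (c j))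
    (F : Fin (l + N) → Fin l → LaurentPolynomial R) (r : Fin (l + N) → Fin N → R) :
    κ (Matrix.of fun i j => Fin.addCases (motive := fun _ => A)
        (fun j => LaurentPolynomial.eval₂ ι (w j) (F i j)) (fun p => ι (r i p)) j).det
      = (Matrix.of fun i j => Fin.addCases (motive := fun _ => R)
        (fun j => (F i j).coeff (c j)) (fun p => r i p) j).det := by
  rw [Matrix.det_apply', Matrix.det_apply', map_sum]
  refine Finset.sum_congr rfl fun σ _ => ?_
  -- Each term of the Leibniz expansion has one entry from every column: the last columns and the
  -- sign come out as scalars, and the first ones form a product that κ evaluates factor by factor.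
  have e : ((σ.sign : ℤ) : A) = ι ((σ.sign : ℤ) : R) := by simp
  simp only [Fin.prod_univ_add, Matrix.of_apply, Fin.addCases_left, Fin.addCases_right]
  rw [← map_prod, e, mul_comm (∏ _, _) (ι _), ← mul_assoc, ← map_mul, hι, hκ]
  ring

end ColumnExtraction

/-! ### Assembly of the matrix element. -/

theorem toSeq_mk_hPM {R : Type*} [CommRing R] {N : ℕ} (x : Fin N → Rˣ) :
    toSeq (PowerSeries.mk fun n : ℕ => hPM x n) = hPM x := by
  funext n
  rcases lt_or_ge n 0 with hn | hn
  · rw [toSeq_of_neg _ hn, hPM, if_neg (by omega)]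
  · obtain ⟨k, rfl⟩ := Int.eq_ofNat_of_zero_le hn
    rw [toSeq_natCast, PowerSeries.coeff_mk]

end SympFock

end

open SympFock in
theorem proposition3p3 {R : Type*} [CommRing R] [Algebra ℚ R] (l N : ℕ)
    (mu : Fin l → ℕ) (hmu : Antitone mu) (lam : Fin (l + N) → ℕ) (hlam : Antitone lam)
    (x : Fin N → Rˣ) :
    SympFock.skewSp x lam mu =
      Matrix.det (Matrix.of fun i j : Fin (l + N) =>
        -- rows and columns are numbered from `0`; the parts of `mu` are extended by `mu_{l+1} = 0`
        if (j : ℕ) ≤ l then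
          SympFock.hPM x ((lam i : ℤ) - (if hj : (j : ℕ) < l then (mu ⟨j, hj⟩ : ℤ) else 0)
            - ((i : ℤ) + 1) + ((j : ℤ) + 1))
        else
          SympFock.hPM x ((lam i : ℤ) - ((i : ℤ) + 1) + ((j : ℤ) + 1)) +
            SympFock.hPM x ((lam i : ℤ) - ((i : ℤ) + 1) - ((j : ℤ) + 1) + 2 * (l : ℤ) + 2)) := by
  obtain ⟨A, _, ι, w, κ, hι, hbra, hκ⟩ := exists_braSp_eq (R := R) mu
  let _ : Algebra ℚ A := (ι.comp (algebraMap ℚ R)).toAlgebra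
  -- Translation by Γ₊ followed by the specialization of the bra: evaluation at the joint alphabet
  -- of the w_j, x_i and their inverses.
  set g : Fock R →+* A := (MvPolynomial.eval₂Hom ι (powerSumPM w)).comp
    (MvPolynomial.aeval (fun n => MvPolynomial.X n + MvPolynomial.C (powerSumPM x n) :
      ℕ+ → Fock R)).toRingHom with hg
  set y : Fin N → Aˣ := fun i => Units.map (ι : R →* A) (x i) with hy
  have hgX (n : ℕ+) : g (MvPolynomial.X n) = powerSumPM w n + powerSumPM y n := by
    change MvPolynomial.eval₂Hom ι (powerSumPM w) (MvPolynomial.aeval _ (MvPolynomial.X n)) = _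
    rw [MvPolynomial.aeval_X, map_add, MvPolynomial.eval₂Hom_X', MvPolynomial.eval₂Hom_C,
      map_powerSumPM]
  have hskew : skewSp x lam mu = κ (weylFactor w * g (ketSp lam)) := by
    rw [skewSp, hbra, gammaPlusPM_eq, annihExp_apply]
    rfl
  set H : PowerSeries A := PowerSeries.map g completeSeries
  set h : PowerSeries R := PowerSeries.mk fun n : ℕ => hPM x n
  have hH : hDenom w * H = PowerSeries.map ι h := by
    have e1 : H * (hDenom w * hDenom y) = 1 := map_completeSeries_mul hgX
    have e2 : hDenom y * PowerSeries.map ι h = 1 := by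
      rw [← map_hDenom, ← map_mul, hDenom_mul_mk_hPM, map_one]
    calc hDenom w * H = hDenom w * H * (hDenom y * PowerSeries.map ι h) := by rw [e2, mul_one]
      _ = H * (hDenom w * hDenom y) * PowerSeries.map ι h := by ring
      _ = PowerSeries.map ι h := by rw [e1, one_mul]
  -- Row i of the ket becomes a functional on polynomials: X acts as t + t⁻¹ on the specialized
  -- complete series, and the coefficient λ_i - i is read off.
  let T (i : Fin (l + N)) : Polynomial A →ₗ[A] A := LinearMap.proj ((lam i : ℤ) - (i : ℕ)) ∘ₗ
    LinearMap.applyₗ (toSeq H) ∘ₗ (Polynomial.aeval (shiftSum A)).toLinearMap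
  have hT (i : Fin (l + N)) (P : Polynomial A) :
      T i P = Polynomial.aeval (shiftSum A) P (toSeq H) ((lam i : ℤ) - (i : ℕ)) := rfl
  have hket : g (ketSp lam) = (Matrix.of fun i j : Fin (l + N) =>
      T i (Polynomial.X ^ (j : ℕ))).det := by
    rw [ketSp_eq_det, RingHom.map_det]
    congr 1
    ext i j
    simp only [RingHom.mapMatrix_apply, Matrix.map_apply, Matrix.of_apply, map_shiftSum_pow,
      ← toSeq_map, hT, map_pow, Polynomial.aeval_X]
    rfl
  have hrow := Matrix.det_mul_row (Fin.addCases (motive := fun _ => A)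
      (fun j : Fin l => (w j : A) ^ (l - 1 - (j : ℕ)) * (1 - (w j : A) ^ 2)) fun _ : Fin N => 1)
    (Matrix.of fun i j : Fin (l + N) => T i (cauchySequence (unitSum w) (dicksonSequence A) l j))
  simp only [Fin.prod_univ_add, Fin.addCases_left, Fin.addCases_right, Finset.prod_const_one,
    mul_one] at hrow
  rw [hskew, weylFactor_eq, mul_assoc, hket,
    ← det_cauchySequence T (unitSum w) (Nat.le_add_right l N) isMonicSequence_dicksonSequence,
    ← hrow]
  -- The shift l - 1 counts the quadratic factors in a column j < l, and l those in a later column;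
  -- if l = 0 the truncated l - 1 is never used, as there is no column of the first kind.
  have hcols := map_det_of_columns ι w κ (fun j => -(mu j : ℤ)) hι hκ
    (fun (i : Fin (l + N)) j =>
      antisymPoly (toSeq h) (l - 1 - (j : ℕ)) ((lam i : ℤ) - (i : ℕ) + (l - 1 : ℕ)))
    (fun (i : Fin (l + N)) (p : Fin N) => if (p : ℕ) = 0 then hPM x ((lam i : ℤ) - (i : ℕ) + l)
      else hPM x ((lam i : ℤ) - (i : ℕ) - (p : ℕ) + l) + hPM x ((lam i : ℤ) - (i : ℕ) + (p : ℕ) + l))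
  have hseq : toSeq h = hPM x := toSeq_mk_hPM x
  convert hcols using 2
  · congr 2
    ext i j
    simp only [Matrix.of_apply]
    refine Fin.addCases (fun j => ?_) (fun p => ?_) j
    · simp only [Fin.addCases_left, Fin.val_castAdd]
      rw [eval₂_antisymPoly, hT, cauchySequence, if_pos j.2, aeval_shiftSum_prod,
        Finset.card_erase_of_mem (Finset.mem_range.mpr j.2), Finset.card_range, mul_assoc]
      congr 1
      -- Multiplying the specialized series by all quadratic factors but the j-th leaves h^x(t)/(1 -
      -- v_j t + t²); the factor 1 - w_j² then makes it an antisymmetric series in w_j alone.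
      have e : PowerSeries.map ι h * antisymSeries (w j) = PowerSeries.C (1 - (w j : A) ^ 2) *
          ((∏ m ∈ (Finset.range l).erase j, quadratic (unitSum w m)) * H) := by
        rw [← quadratic_mul_antisymSeries, ← unitSum_val, ← hH, hDenom_eq_prod_quadratic,
          ← Finset.mul_prod_erase _ _ (Finset.mem_range.mpr j.2)]
        ring
      rw [e, toSeq, toSeq, map_mul _ (PowerSeries.C _), HahnSeries.ofPowerSeries_C, coeff_C_mul]
    · simp only [Fin.addCases_right, Fin.val_natAdd]
      have e : Polynomial.aeval (shiftSum A) (∏ m ∈ Finset.range l,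
          (Polynomial.X - Polynomial.C (unitSum w m))) (toSeq H)
          = fun m => ι (hPM x (m + l)) := by
        funext m
        rw [aeval_shiftSum_prod, ← hDenom_eq_prod_quadratic, hH, toSeq_map, hseq,
          Finset.card_range]
      rw [hT, cauchySequence, if_neg (by omega), mul_comm (Finset.prod _ _), map_mul, Module.End.mul_apply, e,
        one_mul, Nat.add_sub_cancel_left, dicksonSequence]
      split_ifs with hp
      · simp
      · rw [aeval_shiftSum_chebyshev, map_add]
  · ext i j
    simp only [Matrix.of_apply]
    refine Fin.addCases (fun j => ?_) (fun p => ?_) j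
    · simp only [Fin.addCases_left, Fin.val_castAdd]
      -- The index is (λ_i - i + l - 1) - (μ_j + l - 1 - j) = λ_i - μ_j - i + j.
      rw [if_pos j.2.le, dif_pos j.2, coeff_antisymPoly fun n hn => toSeq_of_neg _ hn, hseq]
      congr 1
      have := j.2
      simp only [Fin.eta]
      omega
    · simp only [Fin.addCases_right, Fin.val_natAdd]
      -- The tail column p = 0 is the column j = l of the single-term range, where the extended part
      -- of μ is 0.
      by_cases hp : (p : ℕ) = 0
      · rw [if_pos hp, if_pos (by omega), dif_neg (by omega)]
        congr 1
        omega
      · rw [if_neg hp, if_neg (by omega), add_comm]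
        congr 2 <;> push_cast <;> ring
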